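/- Let $n\ge 1$, $0\le\alpha<n$, $1<p<\infty$ with $\alpha p<n$ (that is, $1<p<n/\alpha$, with $n/0=\infty$), $\frac1q=\frac1p-\frac\alpha n$ and $p'=\frac p{p-1}$. Cubes are closed, nondegenerate and have sides parallel to the axes. A weight is a nonnegative locally integrable function on $\mathbb R^n$. Put $$M_\alpha f(x)=\sup_{Q\ni x}\frac1{|Q|^{1-\alpha/n}}\int_Q|f(y)|\,dy,\qquad M_{\alpha,A^{-1}}f(x)=M_\alpha f(A^{-1}x)$$ for an invertible real $n\times n$ matrix $A$, where the supremum is over cubes $Q$ containing $x$. For nonnegative measurable functions $u,v$ put $$[u,v]_{\mathcal M_{\alpha,p,q}}=\sup_Q\Big(\int_Q v\Big)^{-1/p}\Big(\int_Q M_\alpha(\chi_Qv)^q\,u\Big)^{1/q},$$ and write $(u,v)\in\mathcal M_{\alpha,p,q}$ if $u$ and $v$ are weights and $[u,v]_{\mathcal M_{\alpha,p,q}}<\infty$. For a weight $w$ let $w_A(x)=w(Ax)$ and $[w]_{\mathcal M_{\alpha,A,p,q}}=[w_A^q,w^{-p'}]_{\mathcal M_{\alpha,p,q}}$, and write $w\in\mathcal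 M_{\alpha,A,p,q}$ if $(w_A^q,w^{-p'})\in\mathcal M_{\alpha,p,q}$. There is a finite constant $C=C_{n,p,\alpha}$ such that for every invertible real $n\times n$ matrix $A$ and every weight $w$ that is not almost everywhere zero the following hold. 1. $w\in\mathcal M_{\alpha,A,p,q}$ if and only if there is a finite constant $K$ with $$\Big(\int_{\mathbb R^n}(M_{\alpha,A^{-1}}g)^q\,w^q\Big)^{1/q}\le K\Big(\int_{\mathbb R^n}|g|^p\,w^p\Big)^{1/p}\qquad\text{for all } g\in L^p(w^p).$$ 2. If $w\in\mathcal M_{\alpha,A,p,q}$, then this inequality holds for all $g\in L^p(w^p)$ with $K=C\,|\det A|^{1/q}\,[w]_{\mathcal M_{\alpha,A,p,q}}$. -/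

import Mathlib

open MeasureTheory
open scoped ENNReal NNReal Matrix

noncomputable section

/-- The closed axis-parallel cube with lower corner `a` and side length `l` (used for `l > 0`). -/
def cube {n : ℕ} (a : Fin n → ℝ) (l : ℝ) : Set (Fin n → ℝ) :=
  Set.Icc a (fun i => a i + l)

/-- A weight: a nonnegative, locally integrable function on `ℝⁿ`. Values in `[0, ∞]` are allowed,
so that the negative power `w ^ (-p')` is `∞` (and not a junk value) where `w` vanishes;
local integrability makes a weight finite almost everywhere. -/
structure IsWeight {n : ℕ} (w : (Fin n → ℝ) → ℝ≥0∞) : Prop where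
  aemeasurable : AEMeasurable w volume
  lintegral_lt_top : ∀ K : Set (Fin n → ℝ), IsCompact K → ∫⁻ x in K, w x < ∞

/-- The fractional maximal function `M_α f (x) = sup_{Q ∋ x} |Q|^{α/n - 1} ∫_Q f`, for `f ≥ 0`. -/
def fracMaximal {n : ℕ} (α : ℝ) (f : (Fin n → ℝ) → ℝ≥0∞) (x : Fin n → ℝ) : ℝ≥0∞ :=
  ⨆ (a : Fin n → ℝ) (l : ℝ) (_ : 0 < l) (_ : x ∈ cube a l),
    (volume (cube a l)) ^ (α / n - 1) * ∫⁻ y in cube a l, f y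

/-- The composed maximal operator `M_{α,A⁻¹} g (x) = M_α(|g|)(A⁻¹ x)`. -/
def fracMaximalInv {n : ℕ} (α : ℝ) (A : Matrix (Fin n) (Fin n) ℝ) (g : (Fin n → ℝ) → ℝ)
    (x : Fin n → ℝ) : ℝ≥0∞ :=
  fracMaximal α (fun y => ‖g y‖ₑ) (A⁻¹ *ᵥ x)

/-- Sawyer's testing constant
`[u,v] = sup_Q v(Q)^{-1/p} (∫_Q M_α(χ_Q v)^q u)^{1/q}`, with values in `[0, ∞]`. -/
def sawyerConst {n : ℕ} (α p q : ℝ) (u v : (Fin n → ℝ) → ℝ≥0∞) : ℝ≥0∞ :=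
  ⨆ (a : Fin n → ℝ) (l : ℝ) (_ : 0 < l),
    (∫⁻ x in cube a l, v x) ^ (-(1 / p)) *
      (∫⁻ x in cube a l, (fracMaximal α ((cube a l).indicator v) x) ^ q * u x) ^ (1 / q)

/-- The class `ℳ_{α,p,q}`: pairs of weights with a finite testing constant. -/
structure SawyerPair {n : ℕ} (α p q : ℝ) (u v : (Fin n → ℝ) → ℝ≥0∞) : Prop where
  left : IsWeight u
  right : IsWeight v
  const_lt_top : sawyerConst α p q u v < ∞

/-- The constant `[w]_{ℳ_{α,A,p,q}} = [w_A^q, w^{-p'}]_{ℳ_{α,p,q}}`, where `w_A(x) = w(Ax)`. -/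
def matrixSawyerConst {n : ℕ} (α : ℝ) (A : Matrix (Fin n) (Fin n) ℝ) (p q : ℝ)
    (w : (Fin n → ℝ) → ℝ≥0∞) : ℝ≥0∞ :=
  sawyerConst α p q (fun x => w (A *ᵥ x) ^ q) (fun x => w x ^ (-Real.conjExponent p))

/-- The class `ℳ_{α,A,p,q}`: the weights `w` such that `(w_A^q, w^{-p'})` is in `ℳ_{α,p,q}`. -/
def MatrixSawyerClass {n : ℕ} (α : ℝ) (A : Matrix (Fin n) (Fin n) ℝ) (p q : ℝ)
    (w : (Fin n → ℝ) → ℝ≥0∞) : Prop :=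
  IsWeight w ∧
    SawyerPair α p q (fun x => w (A *ᵥ x) ^ q) (fun x => w x ^ (-Real.conjExponent p))

/-- The norm `‖F‖_{L^r(w^r)} = (∫ F^r w^r)^{1/r}` of a nonnegative function `F`. -/
def weightedNorm {n : ℕ} (r : ℝ) (w F : (Fin n → ℝ) → ℝ≥0∞) : ℝ≥0∞ :=
  (∫⁻ x, F x ^ r * w x ^ r) ^ (1 / r)

/-- The strong bound `‖M_{α,A⁻¹} g‖_{L^q(w^q)} ≤ K ‖g‖_{L^p(w^p)}` for all `g ∈ L^p(w^p)`. -/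
def StrongBound {n : ℕ} (α : ℝ) (A : Matrix (Fin n) (Fin n) ℝ) (p q : ℝ)
    (w : (Fin n → ℝ) → ℝ≥0∞) (K : ℝ≥0∞) : Prop :=
  ∀ g : (Fin n → ℝ) → ℝ, AEStronglyMeasurable g volume →
    weightedNorm p w (fun x => ‖g x‖ₑ) < ∞ →
      weightedNorm q w (fracMaximalInv α A g) ≤ K * weightedNorm p w (fun x => ‖g x‖ₑ)

end

/-! The substitution `x = A y` turns the one-weight inequality for `M_{α,A⁻¹}` into a two-weight
inequality for `M_α` with `u = w_A^q`, `v = w^{-p'}`, and produces the factor `|det A|^{1/q}`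
(`weightedNorm_fracMaximalInv`). What remains is Sawyer's testing theorem.

Sufficiency (`lintegral_fracMaximal_mul_le`). Write `|g| = v f`. Every cube lies in a dyadic cube of
comparable size from one of `2^n` shifted grids, so dyadic maximal operators suffice. For a finite
family of dyadic cubes, give each point to one maximizing cube. With `E_i` the disjoint pieces so
obtained, the integral becomes `∑ c_i (v-mean of f on Q_i)^q`, where `c_i = u(E_i) (|Q_i|^{α/n-1}
v(Q_i))^q`. The testing condition bounds `∑_{Q_i ⊆ Q_j} c_i` by `B v(Q_j)^{q/p}`, and
`IsLaminar.carleson_embedding`, with exponent `r = q/p ≥ 1`, concludes.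

Necessity (`matrixSawyerClass_of_strongBound`). Inserting `χ_Q v` bounds the testing constant, once
`w > 0` a.e. and local integrability of `v` are known. Both follow from the strong bound, applied to
the indicator of `{w = 0}` and to truncations of `v`. -/

/-! ### Layer cake and finite sums in `[0, ∞]` -/

theorem ofReal_mul_lintegral_ite_rpow {r : ℝ} (hr : 0 < r) (a : ℝ≥0∞) :
    ENNReal.ofReal r * ∫⁻ t in Set.Ioi (0 : ℝ),
      (if ENNReal.ofReal t < a then ENNReal.ofReal (t ^ (r - 1)) else 0) = a ^ r := by
  have key : ∀ b : ℝ≥0, ENNReal.ofReal r * ∫⁻ t in Set.Ioi (0 : ℝ),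
      (if ENNReal.ofReal t < b then ENNReal.ofReal (t ^ (r - 1)) else 0) = (b : ℝ≥0∞) ^ r := by
    intro b
    -- The layer-cake formula for a constant function on a one-point space.
    have h := lintegral_rpow_eq_lintegral_meas_lt_mul (Measure.dirac ())
      (f := fun _ => (b : ℝ)) (Filter.Eventually.of_forall fun _ => b.2) aemeasurable_const hr
    rw [lintegral_dirac, ← ENNReal.ofReal_rpow_of_nonneg b.coe_nonneg hr.le, ENNReal.ofReal_coe_nnreal] at h
    rw [h]
    congr 1
    refine setLIntegral_congr_fun measurableSet_Ioi fun t ht => ?_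
    have ht' : (0 : ℝ) < t := ht
    by_cases htb : t < b
    · simp [htb, ENNReal.ofReal_lt_coe_iff ht'.le]
    · simp [htb, ENNReal.ofReal_lt_coe_iff ht'.le]
  induction a with
  | coe b => exact key b
  | top =>
    rw [ENNReal.top_rpow_of_pos hr]
    refine ENNReal.eq_top_of_forall_nnreal_le fun x => ?_
    -- At `∞` the integral dominates the one for `x ^ (1 / r)`, whose value is the arbitrary finite
    -- `x`.
    have h := key (x ^ (1 / r))
    rw [← ENNReal.coe_rpow_of_nonneg _ hr.le, ← NNReal.rpow_mul, one_div,
      inv_mul_cancel₀ hr.ne', NNReal.rpow_one] at h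
    rw [← h]
    gcongr with t
    split_ifs with h1 h2 h2
    · exact le_rfl
    · exact absurd ENNReal.ofReal_lt_top h2
    · exact zero_le
    · exact le_rfl

theorem ENNReal.sum_rpow_le_rpow_sum {ι : Type*} (s : Finset ι) (f : ι → ℝ≥0∞) {r : ℝ}
    (hr : 1 ≤ r) : ∑ i ∈ s, f i ^ r ≤ (∑ i ∈ s, f i) ^ r := by
  classical
  induction s using Finset.induction_on with
  | empty => simp
  | insert a s ha ih =>
    rw [Finset.sum_insert ha, Finset.sum_insert ha]
    exact (add_le_add le_rfl ih).trans (ENNReal.add_rpow_le_rpow_add _ _ hr)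

theorem sum_biUnion_le_sum_sum {ι κ : Type*} [DecidableEq ι] (s : Finset κ) (t : κ → Finset ι)
    (f : ι → ℝ≥0∞) : ∑ i ∈ s.biUnion t, f i ≤ ∑ k ∈ s, ∑ i ∈ t k, f i := by
  classical
  induction s using Finset.induction_on with
  | empty => simp
  | insert a s ha ih =>
    rw [Finset.biUnion_insert, Finset.sum_insert ha]
    refine le_trans ?_ (add_le_add_right ih _)
    rw [← Finset.sum_union_inter]
    exact le_self_add

/-! ### Carleson embedding for laminar families -/

section

variable {X : Type*} [MeasurableSpace X]

/-- Sets any two of which are nested or disjoint. -/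
def IsLaminar {ι : Type*} (Q : ι → Set X) : Prop :=
  ∀ i j, Q i ⊆ Q j ∨ Q j ⊆ Q i ∨ Disjoint (Q i) (Q j)

open Classical in
-- The maximal selected sets are disjoint and contain all the others. Apply `hc` to each of them,
-- add up by superadditivity of `x ↦ x ^ r`, and replace `σ S` by `t⁻¹ ∫_S h`.
theorem IsLaminar.sum_levelSet_le {ι : Type*} {Q : ι → Set X} (hQ : IsLaminar Q)
    (hQm : ∀ i, MeasurableSet (Q i)) (σ : Measure X) (F : Finset ι) (c : ι → ℝ≥0∞) {B : ℝ≥0∞}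
    {r : ℝ} (hr : 1 ≤ r)
    (hc : ∀ j ∈ F, ∑ i ∈ F with Q i ⊆ Q j, c i ≤ B * σ (Q j) ^ r)
    (h : X → ℝ≥0∞) {t : ℝ≥0∞} (ht : t ≠ 0) (ht' : t ≠ ∞) :
    ∑ i ∈ F with t * σ (Q i) < ∫⁻ x in Q i, h x ∂σ, c i ≤ B * (t⁻¹ * ∫⁻ x, h x ∂σ) ^ r := by
  set G := F.filter fun i => t * σ (Q i) < ∫⁻ x in Q i, h x ∂σ with hG
  -- Maximality is among sets, not indices: `Q` need not be injective, and repeated sets would spoil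
  -- disjointness.
  set R := (G.image Q).filter fun S => Maximal (· ∈ G.image Q) S with hR
  have hRG : ∀ S ∈ R, ∃ j ∈ G, Q j = S := fun S hS =>
    Finset.mem_image.1 (Finset.mem_filter.1 hS).1
  have hdisj : (R : Set (Set X)).PairwiseDisjoint id := by
    intro S hS T hT hST
    obtain ⟨i, hi, rfl⟩ := hRG S hS
    obtain ⟨j, hj, rfl⟩ := hRG T hT
    have hSm := (Finset.mem_filter.1 hS).2
    have hTm := (Finset.mem_filter.1 hT).2
    rcases hQ i j with hij | hij | hij
    · exact absurd (hSm.eq_of_le hTm.prop hij) hST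
    · exact absurd (hTm.eq_of_le hSm.prop hij).symm hST
    · exact hij
  calc ∑ i ∈ G, c i ≤ ∑ i ∈ R.biUnion fun S => F.filter fun i => Q i ⊆ S, c i := by
        refine Finset.sum_le_sum_of_subset fun i hi => ?_
        obtain ⟨S, hS, hSmax⟩ := (G.image Q).exists_le_maximal (Finset.mem_image_of_mem Q hi)
        exact Finset.mem_biUnion.2 ⟨S, Finset.mem_filter.2 ⟨hSmax.prop, hSmax⟩,
          Finset.mem_filter.2 ⟨(Finset.mem_filter.1 hi).1, hS⟩⟩
    _ ≤ ∑ S ∈ R, ∑ i ∈ F with Q i ⊆ S, c i := sum_biUnion_le_sum_sum _ _ _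
    _ ≤ ∑ S ∈ R, B * σ S ^ r := by
        refine Finset.sum_le_sum fun S hS => ?_
        obtain ⟨j, hj, rfl⟩ := hRG S hS
        exact hc j (Finset.mem_filter.1 hj).1
    _ = B * ∑ S ∈ R, σ S ^ r := by rw [Finset.mul_sum]
    _ ≤ B * (∑ S ∈ R, σ S) ^ r := by gcongr; exact ENNReal.sum_rpow_le_rpow_sum _ _ hr
    _ ≤ B * (∑ S ∈ R, t⁻¹ * ∫⁻ x in S, h x ∂σ) ^ r := by
        gcongr with S hS
        obtain ⟨j, hj, rfl⟩ := hRG S hS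
        have := (Finset.mem_filter.1 hj).2.le
        rw [← ENNReal.div_eq_inv_mul, ENNReal.le_div_iff_mul_le (Or.inl ht) (Or.inl ht'), mul_comm]
        exact this
    _ ≤ B * (t⁻¹ * ∫⁻ x, h x ∂σ) ^ r := by
        rw [← Finset.mul_sum, ← lintegral_biUnion_finset (t := fun S => S) hdisj]
        · gcongr
          exact Measure.restrict_le_self
        · intro S hS
          obtain ⟨j, hj, rfl⟩ := hRG S hS
          exact hQm j

open Classical in
/-- The level sets of the averages of `f` over a finite laminar family are controlled by the part
of `f` above half the level. -/
theorem IsLaminar.sum_average_gt_le {ι : Type*} {Q : ι → Set X} (hQ : IsLaminar Q)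
    (hQm : ∀ i, MeasurableSet (Q i)) (σ : Measure X) (hσ : ∀ i, σ (Q i) ≠ ∞)
    (F : Finset ι) (c : ι → ℝ≥0∞) {B : ℝ≥0∞} {r : ℝ} (hr : 1 ≤ r)
    (hc : ∀ j ∈ F, ∑ i ∈ F with Q i ⊆ Q j, c i ≤ B * σ (Q j) ^ r)
    (f : X → ℝ≥0∞) {t : ℝ≥0∞} (ht : t ≠ 0) (ht' : t ≠ ∞) :
    ∑ i ∈ F with t < (∫⁻ x in Q i, f x ∂σ) / σ (Q i) / 2, c i ≤
      B * (t⁻¹ * ∫⁻ x, (if t < f x then f x else 0) ∂σ) ^ r := by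
  refine le_trans (Finset.sum_le_sum_of_subset fun i hi => ?_)
    (hQ.sum_levelSet_le hQm σ F c hr hc (fun x => if t < f x then f x else 0) ht ht')
  obtain ⟨hiF, hi⟩ := Finset.mem_filter.1 hi
  refine Finset.mem_filter.2 ⟨hiF, ?_⟩
  have h1 : t * 2 * σ (Q i) < ∫⁻ x in Q i, f x ∂σ := by
    refine ENNReal.mul_lt_of_lt_div ?_
    exact ENNReal.mul_lt_of_lt_div hi
  -- The mean exceeds `2t`, while the part of `f` below level `t` accounts for at most `t` of it;
  -- hence the half in the statement.
  have h2 : ∫⁻ x in Q i, f x ∂σ ≤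
      (∫⁻ x in Q i, (if t < f x then f x else 0) ∂σ) + t * σ (Q i) := by
    rw [← setLIntegral_const, ← lintegral_add_right _ measurable_const]
    gcongr with x
    split_ifs with h
    · exact le_self_add
    · simpa using h
  have h3 : t * σ (Q i) ≠ ∞ := ENNReal.mul_ne_top ht' (hσ i)
  have h4 := h1.trans_le h2
  rw [mul_two, add_mul] at h4
  exact (ENNReal.add_lt_add_iff_right h3).1 h4

end

section

variable {X : Type*} [MeasurableSpace X]

/-- Tonelli: integrating `(p-1) t^{p-2}` up to `f x` gives `f x ^ (p-1)`, and the factor `f x`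
completes the power. -/
theorem lintegral_lintegral_gt_mul_rpow (σ : Measure X) [SFinite σ] {f : X → ℝ≥0∞}
    (hf : Measurable f) {p : ℝ} (hp : 1 < p) :
    ENNReal.ofReal (p - 1) * ∫⁻ t in Set.Ioi (0 : ℝ),
      (∫⁻ x, (if ENNReal.ofReal t < f x then f x else 0) ∂σ) * ENNReal.ofReal (t ^ (p - 1 - 1)) =
    ∫⁻ x, f x ^ p ∂σ := by
  have hmeas : Measurable fun z : ℝ × X =>
      (if ENNReal.ofReal z.1 < f z.2 then f z.2 else 0) * ENNReal.ofReal (z.1 ^ (p - 1 - 1)) := by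
    refine Measurable.mul (Measurable.ite ?_ (by fun_prop) measurable_const) (by fun_prop)
    exact measurableSet_lt (by fun_prop) (by fun_prop)
  have h1 : ∫⁻ t in Set.Ioi (0 : ℝ),
      (∫⁻ x, (if ENNReal.ofReal t < f x then f x else 0) ∂σ) * ENNReal.ofReal (t ^ (p - 1 - 1)) =
      ∫⁻ t in Set.Ioi (0 : ℝ), ∫⁻ x,
        (if ENNReal.ofReal t < f x then f x else 0) * ENNReal.ofReal (t ^ (p - 1 - 1)) ∂σ := by
    refine lintegral_congr fun t => ?_
    rw [lintegral_mul_const' _ _ ENNReal.ofReal_ne_top]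
  rw [h1, lintegral_lintegral_swap hmeas.aemeasurable, ← lintegral_const_mul' _ _ ENNReal.ofReal_ne_top]
  refine lintegral_congr fun x => ?_
  have h2 : ∀ t : ℝ, (if ENNReal.ofReal t < f x then f x else 0) * ENNReal.ofReal (t ^ (p - 1 - 1)) =
      f x * (if ENNReal.ofReal t < f x then ENNReal.ofReal (t ^ (p - 1 - 1)) else 0) := by
    intro t; split_ifs <;> simp
  simp_rw [h2]
  rw [lintegral_const_mul, mul_left_comm, ofReal_mul_lintegral_ite_rpow (by linarith)]
  · conv_lhs => rw [← ENNReal.rpow_one (f x), ← ENNReal.rpow_mul, one_mul]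
    rw [← ENNReal.rpow_add_of_nonneg _ _ zero_le_one (by linarith)]
    congr 1; ring
  · exact Measurable.ite (measurableSet_lt (by fun_prop) measurable_const) (by fun_prop)
      measurable_const

theorem lintegral_gt_le_rpow_mul (σ : Measure X) (f : X → ℝ≥0∞) {p : ℝ} (hp : 1 < p)
    {T : ℝ≥0∞} (hT : T ≠ 0) (hT' : T ≠ ∞) :
    ∫⁻ x, (if T < f x then f x else 0) ∂σ ≤ T ^ (1 - p) * ∫⁻ x, f x ^ p ∂σ := by
  rw [← lintegral_const_mul' _ _ (ENNReal.rpow_ne_top_of_ne_zero hT hT')]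
  refine lintegral_mono fun x => ?_
  dsimp only
  split_ifs with h
  · have h0 : f x ≠ 0 := (pos_of_gt h).ne'
    by_cases hx : f x = ∞
    · rw [hx, ENNReal.top_rpow_of_pos (by linarith), ENNReal.mul_top]
      exact (ENNReal.rpow_pos (pos_iff_ne_zero.2 hT) hT').ne'
    · have h3 : f x = f x ^ (1 - p) * f x ^ p := by
        rw [← ENNReal.rpow_add _ _ h0 hx]; simp
      conv_lhs => rw [h3]
      gcongr ?_ * _
      rw [← neg_sub p 1, ENNReal.rpow_neg, ENNReal.rpow_neg]
      gcongr
  · exact zero_le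

open Classical in
-- By layer cake, the sum is an integral in `t` of `t^{pr-1}` times the sum of `c_i` over half-means
-- above `t`, which is at most `B (t⁻¹ φ(t))^r` with `φ(t) = ∫_{f>t} f`. Integrating one factor `φ`
-- by Tonelli gives the remaining power of `N`. Halving the means costs `2^{pr}`.
theorem IsLaminar.carleson_embedding {ι : Type*} {Q : ι → Set X} (hQ : IsLaminar Q)
    (hQm : ∀ i, MeasurableSet (Q i)) (σ : Measure X) [SFinite σ] (hσ : ∀ i, σ (Q i) ≠ ∞)
    (F : Finset ι) (c : ι → ℝ≥0∞) {B : ℝ≥0∞} {p r : ℝ} (hp : 1 < p) (hr : 1 ≤ r)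
    (hc : ∀ j ∈ F, ∑ i ∈ F with Q i ⊆ Q j, c i ≤ B * σ (Q j) ^ r)
    {f : X → ℝ≥0∞} (hf : Measurable f) :
    ∑ i ∈ F, c i * ((∫⁻ x in Q i, f x ∂σ) / σ (Q i)) ^ (p * r) ≤
      2 ^ (p * r) * ENNReal.ofReal (p * r) / ENNReal.ofReal (p - 1) *
        (B * (∫⁻ x, f x ^ p ∂σ) ^ r) := by
  have hq : 0 < p * r := by positivity
  set N := ∫⁻ x, f x ^ p ∂σ with hN
  set φ : ℝ → ℝ≥0∞ := fun t => ∫⁻ x, (if ENNReal.ofReal t < f x then f x else 0) ∂σ with hφ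
  set a : ι → ℝ≥0∞ := fun i => (∫⁻ x in Q i, f x ∂σ) / σ (Q i) / 2 with ha
  have h1 : ∀ i, c i * ((∫⁻ x in Q i, f x ∂σ) / σ (Q i)) ^ (p * r) =
      2 ^ (p * r) * ENNReal.ofReal (p * r) * ∫⁻ t in Set.Ioi (0 : ℝ),
        c i * (if ENNReal.ofReal t < a i then ENNReal.ofReal (t ^ (p * r - 1)) else 0) := by
    intro i
    have h2 : (∫⁻ x in Q i, f x ∂σ) / σ (Q i) = 2 * a i := by
      rw [ha]
      exact (ENNReal.mul_div_cancel two_ne_zero ENNReal.ofNat_ne_top).symm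
    rw [h2, ENNReal.mul_rpow_of_nonneg _ _ hq.le, ← ofReal_mul_lintegral_ite_rpow hq (a i),
      lintegral_const_mul]
    · ring
    · exact Measurable.ite (measurableSet_lt (by fun_prop) measurable_const) (by fun_prop)
        measurable_const
  have hpt : ∀ t ∈ Set.Ioi (0 : ℝ), (∑ i ∈ F,
      c i * (if ENNReal.ofReal t < a i then ENNReal.ofReal (t ^ (p * r - 1)) else 0)) ≤
      B * N ^ (r - 1) * (φ t * ENNReal.ofReal (t ^ (p - 1 - 1))) := by
    intro t ht
    have ht0 : 0 < t := ht
    set T := ENNReal.ofReal t with hT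
    have hT0 : T ≠ 0 := (ENNReal.ofReal_pos.2 ht0).ne'
    have hT1 : T ≠ ∞ := ENNReal.ofReal_ne_top
    rw [← ENNReal.ofReal_rpow_of_pos ht0, ← ENNReal.ofReal_rpow_of_pos ht0, ← hT]
    simp only [mul_ite, mul_zero]
    rw [← Finset.sum_filter, ← Finset.sum_mul]
    -- One factor `φ t` is kept; the other `r - 1` are bounded by `T^{1-p} N`. The exponents of `T`
    -- then add up to `p - 2`.
    have h3 : φ t ^ r ≤ φ t * (T ^ ((1 - p) * (r - 1)) * N ^ (r - 1)) := by
      have h4 : φ t ^ r = φ t * φ t ^ (r - 1) := by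
        conv_rhs => rw [← ENNReal.rpow_one (φ t), ← ENNReal.rpow_mul, one_mul]
        rw [← ENNReal.rpow_add_of_nonneg _ _ zero_le_one (by linarith)]
        congr 1; ring
      rw [h4, ENNReal.rpow_mul, ← ENNReal.mul_rpow_of_nonneg _ _ (by linarith)]
      have := lintegral_gt_le_rpow_mul σ f hp hT0 hT1
      gcongr
    calc (∑ i ∈ F with T < a i, c i) * T ^ (p * r - 1)
        ≤ (B * (T⁻¹ * φ t) ^ r) * T ^ (p * r - 1) := by
          gcongr
          exact hQ.sum_average_gt_le hQm σ hσ F c hr hc f hT0 hT1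
      _ = B * φ t ^ r * (T ^ (-r) * T ^ (p * r - 1)) := by
          rw [ENNReal.mul_rpow_of_nonneg _ _ (by linarith), ENNReal.inv_rpow, ENNReal.rpow_neg]
          ring
      _ ≤ B * (φ t * (T ^ ((1 - p) * (r - 1)) * N ^ (r - 1))) * (T ^ (-r) * T ^ (p * r - 1)) := by
          gcongr
      _ = B * N ^ (r - 1) * (φ t * (T ^ ((1 - p) * (r - 1)) * (T ^ (-r) * T ^ (p * r - 1)))) := by
          ring
      _ = B * N ^ (r - 1) * (φ t * T ^ (p - 1 - 1)) := by
          rw [← ENNReal.rpow_add _ _ hT0 hT1, ← ENNReal.rpow_add _ _ hT0 hT1]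
          congr 3; ring
  have hp1 : ENNReal.ofReal (p - 1) ≠ 0 := (ENNReal.ofReal_pos.2 (by linarith)).ne'
  have hφm : Measurable fun t : ℝ => φ t * ENNReal.ofReal (t ^ (p - 1 - 1)) := by
    refine Measurable.mul ?_ (by fun_prop)
    have : Measurable fun z : ℝ × X => (if ENNReal.ofReal z.1 < f z.2 then f z.2 else 0) :=
      Measurable.ite (measurableSet_lt (by fun_prop) (by fun_prop)) (by fun_prop)
        measurable_const
    exact this.lintegral_prod_right'
  calc ∑ i ∈ F, c i * ((∫⁻ x in Q i, f x ∂σ) / σ (Q i)) ^ (p * r)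
      = 2 ^ (p * r) * ENNReal.ofReal (p * r) * ∫⁻ t in Set.Ioi (0 : ℝ), ∑ i ∈ F,
        c i * (if ENNReal.ofReal t < a i then ENNReal.ofReal (t ^ (p * r - 1)) else 0) := by
        rw [lintegral_finsetSum, Finset.mul_sum]
        · exact Finset.sum_congr rfl fun i _ => h1 i
        · intro i _
          exact (Measurable.ite (measurableSet_lt (by fun_prop) measurable_const) (by fun_prop)
            measurable_const).const_mul _
    _ ≤ 2 ^ (p * r) * ENNReal.ofReal (p * r) * ∫⁻ t in Set.Ioi (0 : ℝ),
        B * N ^ (r - 1) * (φ t * ENNReal.ofReal (t ^ (p - 1 - 1))) :=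
        mul_le_mul_right (setLIntegral_mono' measurableSet_Ioi hpt) _
    _ = 2 ^ (p * r) * ENNReal.ofReal (p * r) * (B * N ^ (r - 1) *
        ((ENNReal.ofReal (p - 1))⁻¹ * N)) := by
        rw [lintegral_const_mul _ hφm]
        congr 2
        rw [hN, ← lintegral_lintegral_gt_mul_rpow σ hf hp,
          ENNReal.inv_mul_cancel_left hp1 ENNReal.ofReal_ne_top]
    _ = 2 ^ (p * r) * ENNReal.ofReal (p * r) / ENNReal.ofReal (p - 1) *
        (B * (N ^ (r - 1) * N)) := by
        simp only [div_eq_mul_inv]; ring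
    _ = _ := by
        congr 2
        conv_lhs => rw [← ENNReal.rpow_one N, ← ENNReal.rpow_mul, one_mul]
        rw [← ENNReal.rpow_add_of_nonneg _ _ (by linarith) zero_le_one, sub_add_cancel]

end

/-! ### Linearization and the testing theorem for laminar families -/

/-- The part of `Q i` on which `i` is the first index maximizing `b` among the sets of the family
`F` that contain the point. -/
def argmaxSet {X : Type*} (Q : ℕ → Set X) (b : ℕ → ℝ≥0∞) (F : Finset ℕ) (i : ℕ) : Set X :=
  Q i \ ⋃ j ∈ F.filter (fun j => b i < b j ∨ b i = b j ∧ j < i), Q j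

theorem argmaxSet_subset {X : Type*} (Q : ℕ → Set X) (b : ℕ → ℝ≥0∞) (F : Finset ℕ) (i : ℕ) :
    argmaxSet Q b F i ⊆ Q i := Set.sdiff_subset

theorem pairwiseDisjoint_argmaxSet {X : Type*} (Q : ℕ → Set X) (b : ℕ → ℝ≥0∞) (F : Finset ℕ) :
    (F : Set ℕ).PairwiseDisjoint (argmaxSet Q b F) := by
  intro i hi j hj hij
  refine Set.disjoint_left.2 fun x hxi hxj => ?_
  simp only [argmaxSet, Set.mem_sdiff, Set.mem_iUnion, Finset.mem_filter, not_exists] at hxi hxj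
  have h1 := fun h => hxi.2 j ⟨hj, h⟩ hxj.1
  have h2 := fun h => hxj.2 i ⟨hi, h⟩ hxi.1
  rcases lt_trichotomy (b i) (b j) with h | h | h
  · exact h1 (Or.inl h)
  · rcases lt_or_gt_of_ne hij with h' | h'
    · exact h2 (Or.inr ⟨h.symm, h'⟩)
    · exact h1 (Or.inr ⟨h, h'⟩)
  · exact h2 (Or.inl h)

theorem iSup_indicator_le_sum_argmaxSet {X : Type*} (Q : ℕ → Set X) (b : ℕ → ℝ≥0∞) (F : Finset ℕ) (x : X) :
    ⨆ i ∈ F, (Q i).indicator (fun _ => b i) x ≤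
      ∑ i ∈ F, (argmaxSet Q b F i).indicator (fun _ => b i) x := by
  classical
  refine iSup₂_le fun k hk => ?_
  by_cases hx : x ∈ Q k
  swap
  · simp [hx]
  -- Lexicographic order with reversed index: largest `b`, ties going to the smallest index, as in
  -- `argmaxSet`.
  obtain ⟨i, hi, hmax⟩ := (F.filter fun i => x ∈ Q i).exists_max_image
    (fun i => toLex (b i, OrderDual.toDual i)) ⟨k, by simp [hk, hx]⟩
  simp only [Finset.mem_filter] at hi hmax
  have hxi : x ∈ argmaxSet Q b F i := by
    refine ⟨hi.2, ?_⟩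
    simp only [Set.mem_iUnion, Finset.mem_filter, not_exists]
    rintro j ⟨hj, hlt⟩ hxj
    refine absurd (hmax j ⟨hj, hxj⟩) (not_le.2 ?_)
    rw [Prod.Lex.toLex_lt_toLex]
    simpa using hlt
  calc (Q k).indicator (fun _ => b k) x = b k := by simp [hx]
    _ ≤ b i := by
      have := hmax k ⟨hk, hx⟩
      rw [Prod.Lex.toLex_le_toLex] at this
      rcases this with h | h
      · exact h.le
      · exact h.1.le
    _ = (argmaxSet Q b F i).indicator (fun _ => b i) x := by simp [hxi]
    _ ≤ _ := Finset.single_le_sum (f := fun i => (argmaxSet Q b F i).indicator (fun _ => b i) x)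
      (fun _ _ => zero_le) hi.1

section

variable {X : Type*} [MeasurableSpace X]

theorem measurableSet_argmaxSet {Q : ℕ → Set X} (hQm : ∀ i, MeasurableSet (Q i)) (b : ℕ → ℝ≥0∞)
    (F : Finset ℕ) (i : ℕ) : MeasurableSet (argmaxSet Q b F i) :=
  (hQm i).diff (Finset.measurableSet_biUnion _ fun j _ => hQm j)

/-- The pieces are disjoint, and on each the supremum is at least `a i`. The values `a` are
independent of the `b` that shaped the pieces: later `b` involves `f`, and `a` only the testing
data. -/
theorem sum_measure_argmaxSet_le {Q : ℕ → Set X} (hQm : ∀ i, MeasurableSet (Q i))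
    (b a : ℕ → ℝ≥0∞) (F : Finset ℕ) (ν : Measure X) (R : Set X) [DecidablePred fun i => Q i ⊆ R] :
    ∑ i ∈ F with Q i ⊆ R, ν (argmaxSet Q b F i) * a i ≤
      ∫⁻ x in R, ⨆ i, ⨆ (_ : Q i ⊆ R), (Q i).indicator (fun _ => a i) x ∂ν := by
  calc ∑ i ∈ F with Q i ⊆ R, ν (argmaxSet Q b F i) * a i
      = ∑ i ∈ F with Q i ⊆ R, ∫⁻ _ in argmaxSet Q b F i, a i ∂ν := by
        simp [mul_comm]
    _ ≤ ∑ i ∈ F with Q i ⊆ R, ∫⁻ x in argmaxSet Q b F i,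
          ⨆ i, ⨆ (_ : Q i ⊆ R), (Q i).indicator (fun _ => a i) x ∂ν := by
        refine Finset.sum_le_sum fun i hi => setLIntegral_mono' (measurableSet_argmaxSet hQm b F i)
          fun x hx => ?_
        refine le_iSup₂_of_le i (Finset.mem_filter.1 hi).2 ?_
        rw [Set.indicator_of_mem (argmaxSet_subset _ _ _ _ hx)]
    _ = ∫⁻ x in ⋃ i ∈ F.filter (fun i => Q i ⊆ R), argmaxSet Q b F i,
          ⨆ i, ⨆ (_ : Q i ⊆ R), (Q i).indicator (fun _ => a i) x ∂ν := by
        rw [lintegral_biUnion_finset]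
        · exact (pairwiseDisjoint_argmaxSet Q b F).subset
            (Finset.coe_subset.2 (Finset.filter_subset _ _))
        · exact fun i _ => measurableSet_argmaxSet hQm b F i
    _ ≤ _ := by
        refine lintegral_mono_set (Set.iUnion₂_subset fun i hi => ?_)
        exact (argmaxSet_subset _ _ _ _).trans (Finset.mem_filter.1 hi).2

/-- Sawyer's testing theorem for the maximal operator of a countable laminar family. -/
theorem IsLaminar.lintegral_iSup_le {Q : ℕ → Set X} (hQ : IsLaminar Q)
    (hQm : ∀ i, MeasurableSet (Q i)) (σ ν : Measure X) [SFinite σ] (hσ : ∀ i, σ (Q i) ≠ ∞)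
    (hσ0 : ∀ i, σ (Q i) ≠ 0) (κ : ℕ → ℝ≥0∞) {B : ℝ≥0∞} {p r : ℝ} (hp : 1 < p) (hr : 1 ≤ r)
    (htest : ∀ j, ∫⁻ x in Q j, ⨆ i, ⨆ (_ : Q i ⊆ Q j),
      (Q i).indicator (fun _ => (κ i * σ (Q i)) ^ (p * r)) x ∂ν ≤ B * σ (Q j) ^ r)
    {f : X → ℝ≥0∞} (hf : Measurable f) :
    ∫⁻ x, ⨆ i, (Q i).indicator (fun _ => (κ i * ∫⁻ y in Q i, f y ∂σ) ^ (p * r)) x ∂ν ≤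
      2 ^ (p * r) * ENNReal.ofReal (p * r) / ENNReal.ofReal (p - 1) *
        (B * (∫⁻ x, f x ^ p ∂σ) ^ r) := by
  classical
  have hq : 0 < p * r := by positivity
  set b : ℕ → ℝ≥0∞ := fun i => (κ i * ∫⁻ y in Q i, f y ∂σ) ^ (p * r) with hb
  have hsup : ∀ x, ⨆ i, (Q i).indicator (fun _ => b i) x =
      ⨆ N : ℕ, ⨆ i ∈ Finset.range N, (Q i).indicator (fun _ => b i) x := by
    intro x
    refine le_antisymm (iSup_le fun i => ?_) (iSup_le fun N => iSup₂_le fun i _ => ?_)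
    · exact le_iSup_of_le (i + 1) (le_iSup₂_of_le i (by simp) le_rfl)
    · exact le_iSup (fun i => (Q i).indicator (fun _ => b i) x) i
  change ∫⁻ x, ⨆ i, (Q i).indicator (fun _ => b i) x ∂ν ≤ _
  simp_rw [hsup]
  rw [lintegral_iSup]
  · refine iSup_le fun N => ?_
    set F := Finset.range N
    calc ∫⁻ x, ⨆ i ∈ F, (Q i).indicator (fun _ => b i) x ∂ν
        ≤ ∫⁻ x, ∑ i ∈ F, (argmaxSet Q b F i).indicator (fun _ => b i) x ∂ν :=
          lintegral_mono fun x => iSup_indicator_le_sum_argmaxSet Q b F x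
      _ = ∑ i ∈ F, ν (argmaxSet Q b F i) * b i := by
          rw [lintegral_finsetSum]
          · refine Finset.sum_congr rfl fun i _ => ?_
            rw [lintegral_indicator_const (measurableSet_argmaxSet hQm b F i), mul_comm]
          · exact fun i _ => measurable_const.indicator (measurableSet_argmaxSet hQm b F i)
      -- Splitting off the `σ`-mean of `f` leaves coefficients whose Carleson condition is exactly
      -- `htest`.
      _ = ∑ i ∈ F, ν (argmaxSet Q b F i) * (κ i * σ (Q i)) ^ (p * r) *
            ((∫⁻ x in Q i, f x ∂σ) / σ (Q i)) ^ (p * r) := by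
          refine Finset.sum_congr rfl fun i _ => ?_
          rw [mul_assoc, ← ENNReal.mul_rpow_of_nonneg _ _ hq.le, mul_assoc,
            ENNReal.mul_div_cancel (hσ0 i) (hσ i)]
      _ ≤ _ := by
          refine hQ.carleson_embedding hQm σ hσ F _ hp hr (fun j _ => ?_) hf
          exact (sum_measure_argmaxSet_le hQm b _ F ν (Q j)).trans (htest j)
  · intro N
    exact Measurable.iSup fun i => Measurable.iSup fun _ => measurable_const.indicator (hQm i)
  · intro M N hMN x
    exact biSup_mono fun i hi => Finset.range_mono hMN hi

end

/-! ### Dyadic grids and the one-third trick -/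

/-- The half-open dyadic cube of side length `2 ^ k` with index `m` in the grid based at `s`. -/
noncomputable def dyadicCube {n : ℕ} (s : Fin n → ℝ) (c : ℤ × (Fin n → ℤ)) : Set (Fin n → ℝ) :=
  Set.univ.pi fun i => Set.Ico (s i + 2 ^ c.1 * c.2 i) (s i + 2 ^ c.1 * c.2 i + 2 ^ c.1)

/-- The lower corner of a dyadic cube. -/
noncomputable def dyadicCorner {n : ℕ} (s : Fin n → ℝ) (c : ℤ × (Fin n → ℤ)) : Fin n → ℝ :=
  fun i => s i + 2 ^ c.1 * c.2 i

section Dyadic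

variable {n : ℕ} (s : Fin n → ℝ) (c : ℤ × (Fin n → ℤ))

theorem measurableSet_dyadicCube : MeasurableSet (dyadicCube s c) :=
  MeasurableSet.univ_pi fun _ => measurableSet_Ico

theorem dyadicCube_subset_cube : dyadicCube s c ⊆ cube (dyadicCorner s c) (2 ^ c.1) := by
  intro x hx
  simp only [dyadicCube, Set.mem_univ_pi, Set.mem_Ico] at hx
  exact ⟨fun i => (hx i).1, fun i => (hx i).2.le⟩

theorem dyadicCube_ae_eq_cube :
    dyadicCube s c =ᵐ[volume] cube (dyadicCorner s c) (2 ^ c.1) :=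
  Measure.univ_pi_Ico_ae_eq_Icc (μ := fun _ => volume)

variable {s c}

theorem mem_dyadicCube_iff {x : Fin n → ℝ} :
    x ∈ dyadicCube s c ↔ ∀ i, ⌊(x i - s i) / 2 ^ c.1⌋ = c.2 i := by
  have h2 : (0 : ℝ) < 2 ^ c.1 := by positivity
  simp only [dyadicCube, Set.mem_univ_pi, Set.mem_Ico, Int.floor_eq_iff, le_div_iff₀ h2,
    div_lt_iff₀ h2]
  refine forall_congr' fun i => and_congr ?_ ?_
  · constructor <;> intro h <;> linarith
  · constructor <;> intro h <;> linarith

/-- The finer index determines the coarser one, because `⌊t / 2^j⌋ = ⌊⌊t⌋ / 2^j⌋`. -/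
theorem dyadicCube_subset_of_le {c' : ℤ × (Fin n → ℤ)} (hc : c.1 ≤ c'.1)
    {x : Fin n → ℝ} (hx : x ∈ dyadicCube s c) (hx' : x ∈ dyadicCube s c') :
    dyadicCube s c ⊆ dyadicCube s c' := by
  intro y hy
  rw [mem_dyadicCube_iff] at *
  intro i
  obtain ⟨j, hj⟩ := Int.le.dest hc
  have h2 : (2 : ℝ) ^ c'.1 = 2 ^ c.1 * ((2 ^ j : ℕ) : ℝ) := by
    rw [← hj, zpow_add₀ two_ne_zero]; simp
  rw [← hx' i, h2, ← div_div, ← div_div, Int.floor_div_natCast, Int.floor_div_natCast, hx i, hy i]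

theorem isLaminar_dyadicCube {ι : Type*} (e : ι → ℤ × (Fin n → ℤ)) :
    IsLaminar fun i => dyadicCube s (e i) := by
  intro i j
  by_cases hd : Disjoint (dyadicCube s (e i)) (dyadicCube s (e j))
  · exact Or.inr (Or.inr hd)
  obtain ⟨x, hxi, hxj⟩ := Set.not_disjoint_iff.1 hd
  rcases le_total (e i).1 (e j).1 with h | h
  · exact Or.inl (dyadicCube_subset_of_le h hxi hxj)
  · exact Or.inr (Or.inl (dyadicCube_subset_of_le h hxj hxi))

end Dyadic

/-- Since 3 does not divide `2^j`, a shift by `2^N / 3` displaces the grid of each scale `2^k ≤ 2^N`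
by one or two thirds of a cell. -/
theorem two_pow_eq_three_mul_add (j : ℕ) : ∃ c : ℤ, (2 : ℝ) ^ j = 3 * c + 1 ∨
    (2 : ℝ) ^ j = 3 * c + 2 := by
  induction j with
  | zero => exact ⟨0, by norm_num⟩
  | succ j ih =>
    obtain ⟨c, h | h⟩ := ih
    · exact ⟨2 * c, Or.inr (by rw [pow_succ, h]; push_cast; ring)⟩
    · exact ⟨2 * c + 1, Or.inl (by rw [pow_succ, h]; push_cast; ring)⟩

/-- The one-third trick: a short interval lies in a dyadic interval of the standard grid or of the
grid shifted by a third of a larger dyadic length. -/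
theorem exists_shifted_dyadic_interval {N : ℕ} {k : ℤ} (hk : k ≤ N) {a l : ℝ}
    (hl : 3 * l < 2 ^ k) : ∃ t : Bool, ∃ m : ℤ,
      (if t then (2 : ℝ) ^ N / 3 else 0) + 2 ^ k * m ≤ a ∧
      a + l < (if t then (2 : ℝ) ^ N / 3 else 0) + 2 ^ k * m + 2 ^ k := by
  have hL : (0 : ℝ) < 2 ^ k := by positivity
  set L : ℝ := 2 ^ k
  obtain ⟨j, hj⟩ := Int.le.dest hk
  have h2 : (2 : ℝ) ^ N = L * 2 ^ j := by
    rw [← zpow_natCast, ← hj, zpow_add₀ two_ne_zero, zpow_natCast]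
  have h3 : L * ⌊a / L⌋ ≤ a := by
    rw [mul_comm, ← le_div_iff₀ hL]; exact Int.floor_le _
  have h4 : a < L * ⌊a / L⌋ + L := by
    have := Int.lt_floor_add_one (a / L)
    rw [div_lt_iff₀ hL] at this
    linarith
  by_cases h : a + l < L * ⌊a / L⌋ + L
  · exact ⟨false, ⌊a / L⌋, by simpa using h3, by simpa using h⟩
  · rw [not_lt] at h
    obtain ⟨c, hc⟩ := two_pow_eq_three_mul_add j
    -- The interval reaches the right end of its standard cell, so `a` lies in the last third of
    -- that cell, beyond the start of the shifted cell (at one or two thirds).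
    refine ⟨true, ⌊a / L⌋ - c, ?_⟩
    simp only [if_true]
    rw [h2]
    push_cast
    rcases hc with hc | hc <;> rw [hc] <;> constructor <;> nlinarith

/-- The base points of the `2 ^ n` shifted dyadic grids at scales up to `2 ^ N`. -/
noncomputable def dyadicShift {n : ℕ} (N : ℕ) (t : Fin n → Bool) : Fin n → ℝ :=
  fun i => if t i then (2 : ℝ) ^ N / 3 else 0

theorem exists_cube_subset_dyadicCube {n N : ℕ} (a : Fin n → ℝ) {l : ℝ} (hl : 0 < l)
    (hN : 6 * l ≤ 2 ^ N) : ∃ (t : Fin n → Bool) (c : ℤ × (Fin n → ℤ)),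
      cube a l ⊆ dyadicCube (dyadicShift N t) c ∧ (2 : ℝ) ^ c.1 ≤ 6 * l := by
  -- With `2^k ≤ 6l < 2^(k+1)`, the side is comparable to `l` and `3l < 2^k`, as the one-third trick
  -- requires.
  obtain ⟨k, hk1, hk2⟩ := exists_mem_Ico_zpow (x := 6 * l) (y := (2 : ℝ)) (by positivity) one_lt_two
  have hkN : k ≤ N := by
    have := hk1.trans hN
    rw [← zpow_natCast] at this
    exact (zpow_le_zpow_iff_right₀ one_lt_two).1 this
  have h3 : 3 * l < 2 ^ k := by
    rw [zpow_add₀ two_ne_zero, zpow_one] at hk2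
    linarith
  choose t m h using fun i => exists_shifted_dyadic_interval hkN (a := a i) h3
  refine ⟨t, (k, m), fun x hx => ?_, hk1⟩
  simp only [dyadicCube, Set.mem_univ_pi, Set.mem_Ico, dyadicShift]
  intro i
  exact ⟨(h i).1.trans (hx.1 i), (hx.2 i).trans_lt (h i).2⟩

theorem volume_cube {n : ℕ} (a : Fin n → ℝ) (l : ℝ) :
    volume (cube a l) = ENNReal.ofReal l ^ n := by
  simp [cube, Real.volume_Icc_pi]

theorem isCompact_cube {n : ℕ} (a : Fin n → ℝ) (l : ℝ) : IsCompact (cube a l) := isCompact_Icc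

theorem measurableSet_cube {n : ℕ} (a : Fin n → ℝ) (l : ℝ) : MeasurableSet (cube a l) :=
  measurableSet_Icc

theorem volume_cube_rpow_le {n : ℕ} {α l L : ℝ} (hαn : α < n) (hn : 0 < n) (hL : L ≤ 6 * l)
    (a b : Fin n → ℝ) :
    volume (cube a l) ^ (α / n - 1) ≤ 6 ^ (n - α) * volume (cube b L) ^ (α / n - 1) := by
  have hn' : (0 : ℝ) < n := by exact_mod_cast hn
  have he : 0 ≤ 1 - α / n := by
    rw [sub_nonneg, div_le_one hn']; exact hαn.le
  have h6 : (6 : ℝ≥0∞) ^ (n - α) = ((6 : ℝ≥0∞) ^ n) ^ (1 - α / n) := by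
    rw [← ENNReal.rpow_natCast, ← ENNReal.rpow_mul]
    congr 1; field_simp
  have hle : volume (cube b L) ≤ 6 ^ n * volume (cube a l) := by
    rw [volume_cube, volume_cube, ← mul_pow]
    gcongr
    calc ENNReal.ofReal L ≤ ENNReal.ofReal (6 * l) := ENNReal.ofReal_le_ofReal hL
      _ = 6 * ENNReal.ofReal l := by rw [ENNReal.ofReal_mul (by norm_num)]; simp
  have h60 : (6 : ℝ≥0∞) ^ n ≠ 0 := by positivity
  have h61 : (6 : ℝ≥0∞) ^ n ≠ ∞ := ENNReal.pow_ne_top (by simp)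
  rw [h6, ← neg_sub 1, ENNReal.rpow_neg, ENNReal.rpow_neg]
  calc (volume (cube a l) ^ (1 - α / n))⁻¹
      = ((6 : ℝ≥0∞) ^ n) ^ (1 - α / n) * (((6 : ℝ≥0∞) ^ n * volume (cube a l)) ^ (1 - α / n))⁻¹ := by
        rw [ENNReal.mul_rpow_of_ne_top h61 (isCompact_cube a l).measure_ne_top,
          ENNReal.mul_inv (Or.inl (by simp [ENNReal.rpow_eq_zero_iff, h60, h61]))
          (Or.inl (ENNReal.rpow_ne_top_of_nonneg he h61)), ENNReal.mul_inv_cancel_left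
          (by simp [ENNReal.rpow_eq_zero_iff, h60, h61]) (ENNReal.rpow_ne_top_of_nonneg he h61)]
    _ ≤ _ := by gcongr

/-! ### Sawyer's two-weight theorem for `M_α` -/

section Sawyer

variable {n : ℕ} {α p q : ℝ} {u v : (Fin n → ℝ) → ℝ≥0∞}

theorem le_fracMaximal (α : ℝ) (f : (Fin n → ℝ) → ℝ≥0∞) {a x : Fin n → ℝ} {l : ℝ} (hl : 0 < l)
    (hx : x ∈ cube a l) :
    (volume (cube a l)) ^ (α / n - 1) * ∫⁻ y in cube a l, f y ≤ fracMaximal α f x :=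
  le_iSup_of_le a (le_iSup_of_le l (le_iSup_of_le hl (le_iSup_of_le hx le_rfl)))

theorem le_sawyerConst (α p q : ℝ) (u v : (Fin n → ℝ) → ℝ≥0∞) (a : Fin n → ℝ) {l : ℝ}
    (hl : 0 < l) :
    (∫⁻ x in cube a l, v x) ^ (-(1 / p)) *
      (∫⁻ x in cube a l, (fracMaximal α ((cube a l).indicator v) x) ^ q * u x) ^ (1 / q) ≤
      sawyerConst α p q u v :=
  le_iSup_of_le a (le_iSup_of_le l (le_iSup_of_le hl le_rfl))

theorem setLIntegral_cube_ne_top (hv : IsWeight v) (a : Fin n → ℝ) (l : ℝ) :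
    ∫⁻ x in cube a l, v x ≠ ∞ := (hv.lintegral_lt_top _ (isCompact_cube a l)).ne

theorem setLIntegral_cube_ne_zero (hv : AEMeasurable v) (hv0 : ∀ᵐ x, v x ≠ 0)
    (a : Fin n → ℝ) {l : ℝ} (hl : 0 < l) : ∫⁻ x in cube a l, v x ≠ 0 := by
  intro h
  rw [lintegral_eq_zero_iff' hv.restrict] at h
  have h1 : ∀ᵐ x ∂volume.restrict (cube a l), False := by
    filter_upwards [h, ae_restrict_of_ae hv0] with x h1 h2 using h2 h1
  rw [Filter.eventually_false_iff_eq_bot, ae_eq_bot, Measure.restrict_eq_zero, volume_cube] at h1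
  simp [pow_eq_zero_iff', hl.not_ge] at h1

theorem setLIntegral_fracMaximal_le_sawyerConst (hq : 0 < q) (a : Fin n → ℝ) {l : ℝ}
    (hl : 0 < l) (h0 : ∫⁻ x in cube a l, v x ≠ 0) (ht : ∫⁻ x in cube a l, v x ≠ ∞) :
    ∫⁻ x in cube a l, (fracMaximal α ((cube a l).indicator v) x) ^ q * u x ≤
      sawyerConst α p q u v ^ q * (∫⁻ x in cube a l, v x) ^ (q / p) := by
  set I := ∫⁻ x in cube a l, (fracMaximal α ((cube a l).indicator v) x) ^ q * u x
  set V := ∫⁻ x in cube a l, v x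
  have h1 : I ^ (1 / q) ≤ sawyerConst α p q u v * V ^ (1 / p) := by
    have := le_sawyerConst α p q u v a hl
    calc I ^ (1 / q) = V ^ (-(1 / p)) * I ^ (1 / q) * V ^ (1 / p) := by
          rw [mul_right_comm, ← ENNReal.rpow_add _ _ h0 ht]; simp
      _ ≤ _ := by gcongr
  calc I = (I ^ (1 / q)) ^ q := by
        rw [← ENNReal.rpow_mul, one_div, inv_mul_cancel₀ hq.ne', ENNReal.rpow_one]
    _ ≤ (sawyerConst α p q u v * V ^ (1 / p)) ^ q := by gcongr
    _ = _ := by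
        rw [ENNReal.mul_rpow_of_nonneg _ _ hq.le, ← ENNReal.rpow_mul]
        congr 2; ring

/-- The fractional maximal function of `f`, raised to the power `q`, over a countable family of
dyadic cubes. -/
noncomputable def dyadicMaximalRpow (α q : ℝ) (s : Fin n → ℝ) (e : ℕ → ℤ × (Fin n → ℤ))
    (μ : Measure (Fin n → ℝ)) (f : (Fin n → ℝ) → ℝ≥0∞) (x : Fin n → ℝ) : ℝ≥0∞ :=
  ⨆ i, (dyadicCube s (e i)).indicator (fun _ =>
    (volume (cube (dyadicCorner s (e i)) (2 ^ (e i).1)) ^ (α / n - 1) *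
      ∫⁻ y in dyadicCube s (e i), f y ∂μ) ^ q) x

theorem measurable_dyadicMaximalRpow (α q : ℝ) (s : Fin n → ℝ) (e : ℕ → ℤ × (Fin n → ℤ))
    (μ : Measure (Fin n → ℝ)) (f : (Fin n → ℝ) → ℝ≥0∞) :
    Measurable (dyadicMaximalRpow α q s e μ f) :=
  Measurable.iSup fun i => measurable_const.indicator (measurableSet_dyadicCube s (e i))

/-- The laminar theorem with `σ = v dx`, `ν = u dx`, `κ = |Q|^{α/n-1}` and `r = q/p`. Its test
follows from Sawyer's on the closed cube, which differs from the dyadic one by a null set. -/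
theorem lintegral_dyadicMaximalRpow_le (hp : 1 < p) (hpq : p ≤ q) (hu : AEMeasurable u)
    (hv : IsWeight v) (hv0 : ∀ᵐ x, v x ≠ 0) (s : Fin n → ℝ) (e : ℕ → ℤ × (Fin n → ℤ))
    {f : (Fin n → ℝ) → ℝ≥0∞} (hf : Measurable f) :
    ∫⁻ x, dyadicMaximalRpow α q s e (volume.withDensity v) f x ∂(volume.withDensity u) ≤
      2 ^ q * ENNReal.ofReal q / ENNReal.ofReal (p - 1) *
        (sawyerConst α p q u v ^ q * (∫⁻ x, f x ^ p ∂(volume.withDensity v)) ^ (q / p)) := by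
  have hp0 : 0 < p := by linarith
  have hq0 : 0 < q := by linarith
  have hpr : p * (q / p) = q := by field_simp
  have h2 : ∀ k : ℤ, (0 : ℝ) < 2 ^ k := fun k => by positivity
  have hmass : ∀ c, (volume.withDensity v) (dyadicCube s c) =
      ∫⁻ x in cube (dyadicCorner s c) (2 ^ c.1), v x := by
    intro c
    rw [withDensity_apply _ (measurableSet_dyadicCube s c),
      Measure.restrict_congr_set (dyadicCube_ae_eq_cube s c)]
  have htop : ∀ c, (volume.withDensity v) (dyadicCube s c) ≠ ∞ := fun c => by
    rw [hmass]; exact setLIntegral_cube_ne_top hv _ _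
  have hzero : ∀ c, (volume.withDensity v) (dyadicCube s c) ≠ 0 := fun c => by
    rw [hmass]; exact setLIntegral_cube_ne_zero hv.aemeasurable hv0 _ (h2 _)
  have key := (isLaminar_dyadicCube (s := s) e).lintegral_iSup_le
    (fun i => measurableSet_dyadicCube s (e i)) (volume.withDensity v) (volume.withDensity u)
    (fun i => htop _) (fun i => hzero _)
    (fun i => volume (cube (dyadicCorner s (e i)) (2 ^ (e i).1)) ^ (α / n - 1))
    (B := sawyerConst α p q u v ^ q) hp ((one_le_div hp0).2 hpq) ?_ hf
  · rw [hpr] at key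
    exact key
  intro j
  rw [hpr, setLIntegral_withDensity_eq_lintegral_mul₀' hu]
  rotate_left
  · exact (Measurable.iSup fun i => Measurable.iSup fun _ =>
      measurable_const.indicator (measurableSet_dyadicCube s (e i))).aemeasurable
  · exact measurableSet_dyadicCube s (e j)
  rw [hmass (e j), Measure.restrict_congr_set (dyadicCube_ae_eq_cube s (e j))]
  refine le_trans ?_ (setLIntegral_fracMaximal_le_sawyerConst hq0 _ (h2 _)
    (setLIntegral_cube_ne_zero hv.aemeasurable hv0 _ (h2 _)) (setLIntegral_cube_ne_top hv _ _))
  refine lintegral_mono fun x => ?_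
  simp only [Pi.mul_apply]
  rw [mul_comm]
  gcongr
  refine iSup₂_le fun i hi => ?_
  by_cases hx : x ∈ dyadicCube s (e i)
  swap
  · simp [hx]
  rw [Set.indicator_of_mem hx]
  gcongr
  refine le_trans ?_ (le_fracMaximal α _ (h2 (e i).1) (dyadicCube_subset_cube s (e i) hx))
  gcongr
  rw [withDensity_apply _ (measurableSet_dyadicCube s _),
    setLIntegral_indicator (measurableSet_cube _ _)]
  exact lintegral_mono_set (Set.subset_inter (hi.trans (dyadicCube_subset_cube s (e j)))
    (dyadicCube_subset_cube s (e i)))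

/-- The grids at stage `N` serve only cubes with `6l ≤ 2^N`, and the shift changes with `N`. A fixed
cube is served by all large `N`, hence the liminf. -/
theorem fracMaximal_mul_rpow_le_liminf (hα : 0 ≤ α) (hαn : α < n) (hq : 0 < q)
    (hv : AEMeasurable v) {e : ℕ → ℤ × (Fin n → ℤ)} (he : Function.Surjective e)
    {f : (Fin n → ℝ) → ℝ≥0∞} (hf : Measurable f) (x : Fin n → ℝ) :
    fracMaximal α (fun y => v y * f y) x ^ q ≤ 6 ^ ((n - α) * q) * Filter.liminf (fun N : ℕ =>
      ∑ t : Fin n → Bool, dyadicMaximalRpow α q (dyadicShift N t) e (volume.withDensity v) f x)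
      Filter.atTop := by
  have hn : 0 < n := by exact_mod_cast hα.trans_lt hαn
  rw [← ENNReal.le_rpow_inv_iff hq]
  refine iSup₂_le fun a l => iSup₂_le fun hl hx => ?_
  rw [ENNReal.le_rpow_inv_iff hq]
  set I := (volume (cube a l) ^ (α / n - 1) * ∫⁻ y in cube a l, v y * f y) ^ q with hI
  have h6 : (6 : ℝ≥0∞) ^ ((n - α) * q) ≠ 0 := by
    simp [ENNReal.rpow_eq_zero_iff]
  have h6' : (6 : ℝ≥0∞) ^ ((n - α) * q) ≠ ∞ := by
    refine ENNReal.rpow_ne_top_of_nonneg (mul_nonneg (by linarith) hq.le) (by simp)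
  rw [mul_comm, ← ENNReal.div_le_iff_le_mul (Or.inl h6) (Or.inl h6')]
  refine Filter.le_liminf_of_le (by isBoundedDefault) ?_
  obtain ⟨N₀, hN₀⟩ := pow_unbounded_of_one_lt (6 * l) (one_lt_two (α := ℝ))
  filter_upwards [Filter.eventually_ge_atTop N₀] with N hN
  have hlN : 6 * l ≤ 2 ^ N := hN₀.le.trans (pow_le_pow_right₀ one_le_two hN)
  obtain ⟨t, c, hsub, hc⟩ := exists_cube_subset_dyadicCube a hl hlN
  obtain ⟨i, rfl⟩ := he c
  refine le_trans ?_ (Finset.single_le_sum (f := fun t => dyadicMaximalRpow α q (dyadicShift N t) e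
    (volume.withDensity v) f x) (fun _ _ => zero_le) (Finset.mem_univ t))
  refine le_trans ?_ (le_iSup _ i)
  rw [Set.indicator_of_mem (hsub hx), ENNReal.div_le_iff_le_mul (Or.inl h6) (Or.inl h6'), hI,
    mul_comm _ ((6 : ℝ≥0∞) ^ _), ENNReal.rpow_mul, ← ENNReal.mul_rpow_of_nonneg _ _ hq.le, ← mul_assoc]
  refine ENNReal.rpow_le_rpow (mul_le_mul' ?_ ?_) hq.le
  · exact volume_cube_rpow_le hαn hn hc _ _
  · rw [setLIntegral_withDensity_eq_lintegral_mul₀' hv hf.aemeasurable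
      (measurableSet_dyadicCube _ _)]
    exact lintegral_mono_set hsub

/-- Sawyer's two-weight theorem for the fractional maximal operator. -/
theorem lintegral_fracMaximal_mul_le (hα : 0 ≤ α) (hαn : α < n) (hp : 1 < p) (hpq : p ≤ q)
    (hu : AEMeasurable u) (hv : IsWeight v) (hv0 : ∀ᵐ x, v x ≠ 0)
    {f : (Fin n → ℝ) → ℝ≥0∞} (hf : Measurable f) :
    ∫⁻ x, fracMaximal α (fun y => v y * f y) x ^ q * u x ≤
      6 ^ ((n - α) * q) * (2 ^ n * (2 ^ q * ENNReal.ofReal q / ENNReal.ofReal (p - 1))) *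
        (sawyerConst α p q u v ^ q * (∫⁻ x, v x * f x ^ p) ^ (q / p)) := by
  have hq : 0 < q := by linarith
  obtain ⟨e, he⟩ := exists_surjective_nat (ℤ × (Fin n → ℤ))
  set G : ℕ → (Fin n → ℝ) → ℝ≥0∞ := fun N x => ∑ t : Fin n → Bool,
    dyadicMaximalRpow α q (dyadicShift N t) e (volume.withDensity v) f x with hG
  have hGm : ∀ N, Measurable (G N) := fun N =>
    Finset.measurable_fun_sum _ fun t _ => measurable_dyadicMaximalRpow _ _ _ _ _ _
  have hN : ∫⁻ x, f x ^ p ∂(volume.withDensity v) = ∫⁻ x, v x * f x ^ p :=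
    lintegral_withDensity_eq_lintegral_mul₀ hv.aemeasurable (hf.pow_const p).aemeasurable
  have h6' : (6 : ℝ≥0∞) ^ ((n - α) * q) ≠ ∞ :=
    ENNReal.rpow_ne_top_of_nonneg (mul_nonneg (by linarith) hq.le) (by simp)
  calc ∫⁻ x, fracMaximal α (fun y => v y * f y) x ^ q * u x
      ≤ ∫⁻ x, 6 ^ ((n - α) * q) * (u * fun x => Filter.liminf (fun N => G N x) Filter.atTop) x := by
        refine lintegral_mono fun x => ?_
        rw [Pi.mul_apply, mul_comm (u x), ← mul_assoc]
        exact mul_le_mul_left (fracMaximal_mul_rpow_le_liminf hα hαn hq hv.aemeasurable he hf x) _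
    _ = 6 ^ ((n - α) * q) *
        ∫⁻ x, Filter.liminf (fun N => G N x) Filter.atTop ∂(volume.withDensity u) := by
        rw [lintegral_const_mul' _ _ h6', lintegral_withDensity_eq_lintegral_mul₀ hu
          (Measurable.liminf hGm).aemeasurable]
    _ ≤ 6 ^ ((n - α) * q) * (2 ^ n * (2 ^ q * ENNReal.ofReal q / ENNReal.ofReal (p - 1) *
        (sawyerConst α p q u v ^ q * (∫⁻ x, v x * f x ^ p) ^ (q / p)))) := by
        gcongr
        -- Fatou: the bound for `G N` is uniform in `N`, with `2^n` counting the grids.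
        refine (lintegral_liminf_le hGm).trans ?_
        refine Filter.liminf_le_of_le (by isBoundedDefault) fun b hb => ?_
        obtain ⟨N, hbN⟩ := hb.exists
        refine hbN.trans ?_
        simp only [hG]
        rw [lintegral_finsetSum _ fun t _ => measurable_dyadicMaximalRpow _ _ _ _ _ _]
        refine (Finset.sum_le_card_nsmul _ _ _ fun t _ =>
          lintegral_dyadicMaximalRpow_le hp hpq hu hv hv0 _ e hf).trans ?_
        rw [hN]
        simp
    _ = _ := by ring

end Sawyer

/-! ### Change of variables and sufficiency -/

section Matrix

variable {n : ℕ} {α p q : ℝ} {A : Matrix (Fin n) (Fin n) ℝ} {w : (Fin n → ℝ) → ℝ≥0∞}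

theorem map_mulVec_volume (hA : A.det ≠ 0) :
    Measure.map (A *ᵥ ·) (volume : Measure (Fin n → ℝ)) = ENNReal.ofReal |A.det⁻¹| • volume :=
  Real.map_matrix_volume_pi_eq_smul_volume_pi hA

/-- An invertible matrix is a measurable embedding, so `F` need not be measurable. -/
theorem lintegral_eq_det_mul_lintegral_mulVec (hA : A.det ≠ 0) (F : (Fin n → ℝ) → ℝ≥0∞) :
    ∫⁻ x, F x = ENNReal.ofReal |A.det| * ∫⁻ y, F (A *ᵥ y) := by
  have hemb : MeasurableEmbedding (A *ᵥ · : (Fin n → ℝ) → Fin n → ℝ) := by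
    refine Continuous.measurableEmbedding (by fun_prop) ?_
    exact Matrix.mulVec_injective_of_isUnit (A.isUnit_iff_isUnit_det.2 hA.isUnit)
  have h := hemb.lintegral_map (μ := volume) F
  rw [map_mulVec_volume hA, lintegral_smul_measure] at h
  rw [← h, smul_eq_mul, ← mul_assoc, ← ENNReal.ofReal_mul (abs_nonneg _), ← abs_mul,
    mul_inv_cancel₀ hA]
  simp

theorem quasiMeasurePreserving_mulVec (hA : A.det ≠ 0) :
    Measure.QuasiMeasurePreserving (A *ᵥ · : (Fin n → ℝ) → Fin n → ℝ) :=
  ⟨(show Continuous (A *ᵥ · : (Fin n → ℝ) → Fin n → ℝ) by fun_prop).measurable, by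
    rw [map_mulVec_volume hA]; exact Measure.smul_absolutelyContinuous⟩

theorem IsWeight.ae_lt_top {v : (Fin n → ℝ) → ℝ≥0∞} (hv : IsWeight v) : ∀ᵐ x, v x < ∞ := by
  have h : ∀ k : ℕ, ∀ᵐ x ∂volume.restrict (Metric.closedBall (0 : Fin n → ℝ) k), v x < ∞ :=
    fun k => ae_lt_top' hv.aemeasurable.restrict
      (hv.lintegral_lt_top _ (isCompact_closedBall 0 (k : ℝ))).ne
  have h2 := ae_restrict_iUnion_iff (μ := volume)
    (fun k : ℕ => Metric.closedBall (0 : Fin n → ℝ) k) (fun x => v x < ∞) |>.2 h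
  rwa [Metric.iUnion_closedBall_nat, Measure.restrict_univ] at h2

theorem weightedNorm_fracMaximalInv (hA : A.det ≠ 0) (hq : 0 < q) (g : (Fin n → ℝ) → ℝ) :
    weightedNorm q w (fracMaximalInv α A g) = ENNReal.ofReal |A.det| ^ (1 / q) *
      (∫⁻ y, fracMaximal α (fun z => ‖g z‖ₑ) y ^ q * w (A *ᵥ y) ^ q) ^ (1 / q) := by
  rw [weightedNorm, lintegral_eq_det_mul_lintegral_mulVec hA,
    ENNReal.mul_rpow_of_nonneg _ _ (by positivity)]
  simp only [fracMaximalInv, Matrix.mulVec_mulVec, Matrix.nonsing_inv_mul A hA.isUnit,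
    Matrix.one_mulVec]

theorem fracMaximal_congr_ae {f g : (Fin n → ℝ) → ℝ≥0∞} (h : f =ᵐ[volume] g) :
    fracMaximal α f = fracMaximal α g := by
  ext x
  simp only [fracMaximal, lintegral_congr_ae (ae_restrict_of_ae h)]

/-- The power of a weight that makes Sawyer's theorem a one-weight statement. -/
theorem rpow_neg_conjExponent_mul_rpow (hp : 1 < p) {x : ℝ≥0∞} (h0 : x ≠ 0) (ht : x ≠ ∞) :
    (x ^ (-Real.conjExponent p)) ^ p * x ^ p = x ^ (-Real.conjExponent p) := by
  have hp1 : p - 1 ≠ 0 := by linarith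
  rw [← ENNReal.rpow_mul, ← ENNReal.rpow_add _ _ h0 ht, Real.conjExponent]
  congr 1; field_simp; ring

theorem strongBound_of_matrixSawyerClass (hα : 0 ≤ α) (hαn : α < n) (hp : 1 < p) (hpq : p ≤ q)
    (hA : A.det ≠ 0) (hw : MatrixSawyerClass α A p q w) :
    StrongBound α A p q w
      ((6 ^ ((n - α) * q) * (2 ^ n * (2 ^ q * ENNReal.ofReal q / ENNReal.ofReal (p - 1)))) ^ (1 / q) *
        ENNReal.ofReal |A.det| ^ (1 / q) * matrixSawyerConst α A p q w) := by
  intro g hg _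
  have hq : 0 < q := by linarith
  have hp0 : 0 < p := by linarith
  obtain ⟨hww, hpair⟩ := hw
  set v : (Fin n → ℝ) → ℝ≥0∞ := fun x => w x ^ (-Real.conjExponent p) with hv
  have hp1 : 0 < p - 1 := by linarith
  have hp' : 0 < Real.conjExponent p := div_pos hp0 hp1
  have hwt : ∀ᵐ x, w x ≠ ∞ := hww.ae_lt_top.mono fun x hx => hx.ne
  -- `v` is `∞` wherever `w` vanishes, so local integrability of `v` excludes this up to a null set.
  have hw0 : ∀ᵐ x, w x ≠ 0 := by
    filter_upwards [hpair.right.ae_lt_top] with x hx h0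
    refine hx.ne ?_
    rw [hv]
    dsimp only
    rw [h0, ENNReal.zero_rpow_of_neg (by linarith)]
  have hv0 : ∀ᵐ x, v x ≠ 0 := by
    filter_upwards [hwt] with x hx
    simp [hv, ENNReal.rpow_eq_zero_iff, hx, hp'.not_gt]
  -- The density of `|g|` with respect to `v`. Since `p'(p-1) = p`, one has `v f^p = |g|^p w^p`.
  have hfae : AEMeasurable (fun x => ‖g x‖ₑ * w x ^ Real.conjExponent p) :=
    hg.enorm.mul (hww.aemeasurable.pow_const _)
  obtain ⟨f, hf, hfe⟩ := hfae
  have hvf : (fun y => v y * f y) =ᵐ[volume] fun y => ‖g y‖ₑ := by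
    filter_upwards [hfe, hwt, hw0] with x h1 h2 h3
    rw [← h1, mul_left_comm, ← ENNReal.rpow_add _ _ h3 h2]
    simp
  have hvfp : (fun y => v y * f y ^ p) =ᵐ[volume] fun y => ‖g y‖ₑ ^ p * w y ^ p := by
    filter_upwards [hfe, hwt, hw0] with x h1 h2 h3
    rw [← h1, ENNReal.mul_rpow_of_nonneg _ _ hp0.le, mul_left_comm, ← ENNReal.rpow_mul,
      ← ENNReal.rpow_add _ _ h3 h2]
    congr 2
    rw [Real.conjExponent]
    have := hp1.ne'
    field_simp
    ring
  have key := lintegral_fracMaximal_mul_le hα hαn hp hpq hpair.left.aemeasurable hpair.right hv0 hf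
  rw [lintegral_congr_ae hvfp, fracMaximal_congr_ae hvf] at key
  rw [weightedNorm_fracMaximalInv hA hq, weightedNorm, matrixSawyerConst]
  refine (mul_le_mul_right (ENNReal.rpow_le_rpow key (by positivity)) _).trans (le_of_eq ?_)
  rw [ENNReal.mul_rpow_of_nonneg _ _ (by positivity), ENNReal.mul_rpow_of_nonneg (_ ^ q) _
    (by positivity), ← ENNReal.rpow_mul (sawyerConst _ _ _ _ _), ← ENNReal.rpow_mul (∫⁻ y, _),
    mul_one_div_cancel hq.ne', ENNReal.rpow_one, show q / p * (1 / q) = 1 / p by field_simp]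
  ring

end Matrix

/-! ### Necessity of the testing condition -/

section Necessity

variable {n : ℕ} {α p q : ℝ} {A : Matrix (Fin n) (Fin n) ℝ} {w : (Fin n → ℝ) → ℝ≥0∞}

/-- The strong bound, transported by `A` to a two-weight inequality for `M_α`. -/
theorem StrongBound.lintegral_fracMaximal_le (hA : A.det ≠ 0) (hq : 0 < q) {K : ℝ≥0}
    (hK : StrongBound α A p q w K) {F : (Fin n → ℝ) → ℝ≥0∞} (hF : AEMeasurable F)
    (hFt : ∀ᵐ x, F x < ∞) (hFw : ∫⁻ x, F x ^ p * w x ^ p < ∞) (hp : 0 < p) :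
    (∫⁻ y, fracMaximal α F y ^ q * w (A *ᵥ y) ^ q) ^ (1 / q) ≤
      K * ENNReal.ofReal |A.det| ^ (-(1 / q)) * (∫⁻ x, F x ^ p * w x ^ p) ^ (1 / p) := by
  have hg : (fun x => ‖(F x).toReal‖ₑ) =ᵐ[volume] F := by
    filter_upwards [hFt] with x hx
    rw [Real.enorm_of_nonneg ENNReal.toReal_nonneg, ENNReal.ofReal_toReal hx.ne]
  have hN : weightedNorm p w (fun x => ‖(F x).toReal‖ₑ) =
      (∫⁻ x, F x ^ p * w x ^ p) ^ (1 / p) := by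
    rw [weightedNorm]
    congr 1
    refine lintegral_congr_ae ?_
    filter_upwards [hg] with x hx
    rw [hx]
  have h := hK (fun x => (F x).toReal) hF.ennreal_toReal.aestronglyMeasurable
    (by rw [hN]; exact ENNReal.rpow_lt_top_of_nonneg (by positivity) hFw.ne)
  rw [weightedNorm_fracMaximalInv hA hq, hN, fracMaximal_congr_ae hg] at h
  have hD0 : ENNReal.ofReal |A.det| ≠ 0 := by simpa using hA
  have hDt : ENNReal.ofReal |A.det| ≠ ∞ := ENNReal.ofReal_ne_top
  calc (∫⁻ y, fracMaximal α F y ^ q * w (A *ᵥ y) ^ q) ^ (1 / q)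
      = ENNReal.ofReal |A.det| ^ (-(1 / q)) * (ENNReal.ofReal |A.det| ^ (1 / q) *
        (∫⁻ y, fracMaximal α F y ^ q * w (A *ᵥ y) ^ q) ^ (1 / q)) := by
        rw [← mul_assoc, ← ENNReal.rpow_add _ _ hD0 hDt]; simp
    _ ≤ ENNReal.ofReal |A.det| ^ (-(1 / q)) * (K * (∫⁻ x, F x ^ p * w x ^ p) ^ (1 / p)) := by
        gcongr
    _ = _ := by ring

theorem volume_cube_mul_lintegral_le (hq : 0 < q) (F u : (Fin n → ℝ) → ℝ≥0∞)
    (a : Fin n → ℝ) {l : ℝ} (hl : 0 < l) :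
    volume (cube a l) ^ (α / n - 1) * (∫⁻ y in cube a l, F y) *
      (∫⁻ y in cube a l, u y) ^ (1 / q) ≤ (∫⁻ y, fracMaximal α F y ^ q * u y) ^ (1 / q) := by
  set I := volume (cube a l) ^ (α / n - 1) * (∫⁻ y in cube a l, F y) with hI
  -- An infinite constant cannot be pulled out of the integral of a possibly nonmeasurable `u`; the
  -- inequality `lintegral_const_mul_le` is enough.
  by_cases hIt : I = ∞
  · by_cases hu : ∫⁻ y in cube a l, u y = 0
    · rw [hu, ENNReal.zero_rpow_of_pos (by positivity), mul_zero]
      exact zero_le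
    · suffices h : ∫⁻ y, fracMaximal α F y ^ q * u y = ∞ by
        rw [h, ENNReal.top_rpow_of_pos (by positivity)]; exact le_top
      rw [eq_top_iff]
      calc ∞ = ∞ * ∫⁻ y in cube a l, u y := (ENNReal.top_mul hu).symm
        _ ≤ ∫⁻ y in cube a l, ∞ * u y := lintegral_const_mul_le _ _
        _ ≤ ∫⁻ y in cube a l, fracMaximal α F y ^ q * u y := by
            refine setLIntegral_mono' (measurableSet_cube a l) fun y hy => ?_
            have := le_fracMaximal α F hl hy
            rw [← hI, hIt, top_le_iff] at this
            rw [this, ENNReal.top_rpow_of_pos hq]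
        _ ≤ _ := setLIntegral_le_lintegral _ _
  calc I * (∫⁻ y in cube a l, u y) ^ (1 / q) = (∫⁻ y in cube a l, I ^ q * u y) ^ (1 / q) := by
        rw [lintegral_const_mul' _ _ (ENNReal.rpow_ne_top_of_nonneg hq.le hIt),
          ENNReal.mul_rpow_of_nonneg _ _ (by positivity), ← ENNReal.rpow_mul,
          mul_one_div_cancel hq.ne', ENNReal.rpow_one]
    _ ≤ _ := by
        refine ENNReal.rpow_le_rpow (le_trans ?_ (setLIntegral_le_lintegral (cube a l) _))
          (by positivity)
        refine setLIntegral_mono' (measurableSet_cube a l) fun y hy => ?_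
        gcongr
        exact le_fracMaximal α F hl hy

/-- The cube of side length `2 * N` centred at the origin. -/
noncomputable def centeredCube (n N : ℕ) : Set (Fin n → ℝ) := cube (fun _ => -(N : ℝ)) (2 * N)

theorem monotone_centeredCube (n : ℕ) : Monotone (centeredCube n) := by
  intro M N hMN x hx
  have : (M : ℝ) ≤ N := by exact_mod_cast hMN
  refine ⟨fun i => ?_, fun i => ?_⟩
  · have := hx.1 i
    dsimp only at *
    linarith
  · have := hx.2 i
    dsimp only at *
    linarith

theorem closedBall_subset_centeredCube (n N : ℕ) :
    Metric.closedBall (0 : Fin n → ℝ) N ⊆ centeredCube n N := by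
  intro x hx
  rw [mem_closedBall_zero_iff, pi_norm_le_iff_of_nonneg (by positivity)] at hx
  refine ⟨fun i => ?_, fun i => ?_⟩
  · have := abs_le.1 (hx i)
    dsimp only
    linarith
  · have := abs_le.1 (hx i)
    dsimp only
    linarith

theorem iUnion_centeredCube_add (n N₀ : ℕ) : ⋃ N, centeredCube n (N₀ + N) = Set.univ := by
  rw [Set.eq_univ_iff_forall]
  intro x
  obtain ⟨N, hN⟩ := exists_nat_ge ‖x‖
  refine Set.mem_iUnion.2 ⟨N, monotone_centeredCube n (Nat.le_add_left N N₀) ?_⟩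
  exact closedBall_subset_centeredCube n N (mem_closedBall_zero_iff.2 hN)

theorem IsWeight.of_centeredCube {v : (Fin n → ℝ) → ℝ≥0∞} (hv : AEMeasurable v) (N₀ : ℕ)
    (h : ∀ N ≥ N₀, ∫⁻ x in centeredCube n N, v x ≠ ∞) : IsWeight v := by
  refine ⟨hv, fun S hS => ?_⟩
  obtain ⟨r, hr⟩ := hS.isBounded.subset_closedBall 0
  obtain ⟨N, hN⟩ := exists_nat_ge r
  have hsub : S ⊆ centeredCube n (N₀ + N) :=
    (hr.trans (Metric.closedBall_subset_closedBall hN)).trans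
      ((closedBall_subset_centeredCube n N).trans
        (monotone_centeredCube n (Nat.le_add_left N N₀)))
  exact (lintegral_mono_set hsub).trans_lt (h _ (Nat.le_add_right _ _)).lt_top

theorem exists_setLIntegral_centeredCube_ne_zero {u : (Fin n → ℝ) → ℝ≥0∞} (hu : AEMeasurable u)
    (hu0 : ¬ ∀ᵐ x, u x = 0) : ∃ N₀, ∀ N ≥ N₀, ∫⁻ x in centeredCube n N, u x ≠ 0 := by
  by_contra! hcon
  refine hu0 ?_
  have h : ∀ N, ∀ᵐ x ∂volume.restrict (centeredCube n (0 + N)), u x = 0 := by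
    intro N
    obtain ⟨M, hM, h0⟩ := hcon N
    rw [lintegral_eq_zero_iff' hu.restrict] at h0
    exact ae_restrict_of_ae_restrict_of_subset
      (monotone_centeredCube n (by simpa using hM)) h0
  have h2 := (ae_restrict_iUnion_iff (μ := volume)
    (fun N => centeredCube n (0 + N)) (fun x => u x = 0)).2 h
  rwa [iUnion_centeredCube_add, Measure.restrict_univ] at h2

theorem volume_cube_rpow_ne_zero (a : Fin n → ℝ) {l : ℝ} (hl : 0 < l) (s : ℝ) :
    volume (cube a l) ^ s ≠ 0 := by
  refine (ENNReal.rpow_pos ?_ (isCompact_cube a l).measure_ne_top).ne'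
  rw [volume_cube]
  exact ENNReal.pow_pos (ENNReal.ofReal_pos.2 hl) n

theorem lintegral_indicator_dual_weight (hp : 1 < p) (hwt : ∀ᵐ x, w x ≠ ∞)
    (hw0 : ∀ᵐ x, w x ≠ 0) {E : Set (Fin n → ℝ)} (hE : MeasurableSet E) :
    ∫⁻ x, E.indicator (fun x => w x ^ (-Real.conjExponent p)) x ^ p * w x ^ p =
      ∫⁻ x in E, w x ^ (-Real.conjExponent p) := by
  rw [← lintegral_indicator hE]
  refine lintegral_congr_ae ?_
  filter_upwards [hwt, hw0] with x h1 h2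
  by_cases hx : x ∈ E
  · simp [hx, rpow_neg_conjExponent_mul_rpow hp h2 h1]
  · simp [hx, ENNReal.zero_rpow_of_pos (show 0 < p by linarith)]

/-- Everything but the final test comes from `|Q|^{α/n-1} (∫_Q F) u(Q)^{1/q} ≤ K' ‖F‖_{L^p(w^p)}` on
centred cubes large enough that `u(Q) > 0`. -/
theorem matrixSawyerClass_of_strongBound (hp : 1 < p) (hq : 0 < q) (hA : A.det ≠ 0)
    (hw : IsWeight w) (hwz : ¬ ∀ᵐ x, w x = 0) {K : ℝ≥0} (hK : StrongBound α A p q w K) :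
    MatrixSawyerClass α A p q w := by
  have hp0 : 0 < p := by linarith
  have hp1 : 0 < p - 1 := by linarith
  have hp' : 0 < Real.conjExponent p := div_pos hp0 hp1
  set u : (Fin n → ℝ) → ℝ≥0∞ := fun x => w (A *ᵥ x) ^ q with hu
  set v : (Fin n → ℝ) → ℝ≥0∞ := fun x => w x ^ (-Real.conjExponent p) with hv
  set K' : ℝ≥0∞ := K * ENNReal.ofReal |A.det| ^ (-(1 / q)) with hK'
  have hKt : K' ≠ ∞ := ENNReal.mul_ne_top ENNReal.coe_ne_top
    (ENNReal.rpow_ne_top_of_ne_zero (by simpa using hA) ENNReal.ofReal_ne_top)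
  have hum : AEMeasurable u :=
    (hw.aemeasurable.comp_quasiMeasurePreserving (quasiMeasurePreserving_mulVec hA)).pow_const q
  have hvm : AEMeasurable v := hw.aemeasurable.pow_const _
  have hwt : ∀ᵐ x, w x ≠ ∞ := hw.ae_lt_top.mono fun x hx => hx.ne
  have hv0 : ∀ᵐ x, v x ≠ 0 := by
    filter_upwards [hwt] with x hx
    simp [hv, ENNReal.rpow_eq_zero_iff, hx, hp'.not_gt]
  have hu0 : ¬ ∀ᵐ x, u x = 0 := by
    intro h
    refine hwz ?_
    have h1 : ∫⁻ x, w x = 0 := by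
      rw [lintegral_eq_det_mul_lintegral_mulVec hA, lintegral_congr_ae (g := fun _ => 0)]
      · simp
      · filter_upwards [h] with x hx
        simpa [hu, ENNReal.rpow_eq_zero_iff, hq, hq.not_gt] using hx
    exact (lintegral_eq_zero_iff' hw.aemeasurable).1 h1
  obtain ⟨N₁, hN₁⟩ := exists_setLIntegral_centeredCube_ne_zero hum hu0
  have hpos : ∀ N ≥ N₁ + 1, (0 : ℝ) < 2 * N := fun N hN => by
    have : 0 < N := by omega
    positivity
  -- The indicator of `{w = 0}` has norm zero, so it has integral zero on every large centred cube.
  have hw0 : ∀ᵐ x, w x ≠ 0 := by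
    set W := hw.aemeasurable.mk w with hW
    have hWm : Measurable W := hw.aemeasurable.measurable_mk
    have hWe : w =ᵐ[volume] W := hw.aemeasurable.ae_eq_mk
    set Z : Set (Fin n → ℝ) := W ⁻¹' {0} with hZ
    have hZm : MeasurableSet Z := hWm (measurableSet_singleton 0)
    set F : (Fin n → ℝ) → ℝ≥0∞ := Z.indicator 1 with hF
    have hF0 : ∫⁻ x, F x ^ p * w x ^ p = 0 := by
      rw [lintegral_congr_ae (g := fun _ => 0)]
      · simp
      · filter_upwards [hWe] with x hx
        by_cases hxZ : x ∈ Z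
        · have : w x = 0 := hx.trans hxZ
          simp [this, hp0]
        · simp [hF, hxZ, hp0]
    have hbound := hK.lintegral_fracMaximal_le hA hq (F := F)
      ((measurable_const.indicator hZm).aemeasurable)
      (Filter.Eventually.of_forall fun x => by
        by_cases hx : x ∈ Z <;> simp [hF, hx]) (by rw [hF0]; exact ENNReal.zero_lt_top) hp0
    rw [hF0, ENNReal.zero_rpow_of_pos (by positivity), mul_zero] at hbound
    have hnull : ∀ N, ∀ᵐ x ∂volume.restrict (centeredCube n (N₁ + 1 + N)), w x ≠ 0 := by
      intro N
      have hl := hpos (N₁ + 1 + N) (by omega)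
      have h1 := (volume_cube_mul_lintegral_le (α := α) hq F u (fun _ => -((N₁ + 1 + N : ℕ) : ℝ)) hl).trans hbound
      have h2 : ∫⁻ y in centeredCube n (N₁ + 1 + N), F y = 0 := by
        have h3 := le_antisymm h1 zero_le
        rw [mul_eq_zero, mul_eq_zero] at h3
        rcases h3 with (h3 | h3) | h3
        · exact absurd h3 (volume_cube_rpow_ne_zero _ hl _)
        · exact h3
        · rw [ENNReal.rpow_eq_zero_iff] at h3
          rcases h3 with h3 | h3
          · exact absurd h3.1 (hN₁ _ (by omega))
          · exact absurd h3.2 (by simp [hq.le])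
      rw [lintegral_eq_zero_iff (measurable_one.indicator hZm)] at h2
      filter_upwards [h2, ae_restrict_of_ae hWe] with x hx1 hx2 hx3
      have : x ∈ Z := hx2.symm.trans hx3
      simp [this] at hx1
    have h2 := (ae_restrict_iUnion_iff (μ := volume)
      (fun N => centeredCube n (N₁ + 1 + N)) (fun x => w x ≠ 0)).2 hnull
    rwa [iUnion_centeredCube_add, Measure.restrict_univ] at h2
  have hvt : ∀ᵐ x, v x < ∞ := by
    filter_upwards [hw0, hwt] with x h0 h1
    exact (ENNReal.rpow_ne_top_of_ne_zero h0 h1).lt_top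
  have htest : ∀ E : Set (Fin n → ℝ), MeasurableSet E → ∫⁻ x in E, v x ≠ ∞ →
      (∫⁻ y, fracMaximal α (E.indicator v) y ^ q * u y) ^ (1 / q) ≤
        K' * (∫⁻ x in E, v x) ^ (1 / p) := by
    intro E hE hEt
    have h := hK.lintegral_fracMaximal_le hA hq (F := E.indicator v) (hvm.indicator hE)
      (by
        filter_upwards [hvt] with x hx
        exact (Set.indicator_le_self E v x).trans_lt hx)
      (by rw [lintegral_indicator_dual_weight hp hwt hw0 hE]; exact hEt.lt_top) hp0
    rwa [lintegral_indicator_dual_weight hp hwt hw0 hE] at h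
  have hcube : ∀ (a : Fin n → ℝ) (l : ℝ), 0 < l → ∀ E ⊆ cube a l, MeasurableSet E →
      ∫⁻ x in E, v x ≠ ∞ → volume (cube a l) ^ (α / n - 1) * (∫⁻ x in E, v x) *
        (∫⁻ y in cube a l, u y) ^ (1 / q) ≤ K' * (∫⁻ x in E, v x) ^ (1 / p) := by
    intro a l hl E hEsub hE hEt
    have h := (volume_cube_mul_lintegral_le (α := α) hq (E.indicator v) u a hl).trans
      (htest E hE hEt)
    rwa [setLIntegral_indicator hE, Set.inter_eq_left.2 hEsub] at h
  have hvint : ∀ N ≥ N₁ + 1, ∫⁻ x in centeredCube n N, v x ≠ ∞ := by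
    intro N hN
    have hl := hpos N hN
    set R := centeredCube n N with hR
    have hRm : MeasurableSet R := measurableSet_cube _ _
    set d := volume R ^ (α / n - 1) * (∫⁻ y in R, u y) ^ (1 / q) with hd
    have hd0 : d ≠ 0 := by
      refine mul_ne_zero (volume_cube_rpow_ne_zero _ hl _) ?_
      rw [Ne, ENNReal.rpow_eq_zero_iff]
      rintro (h | h)
      · exact hN₁ N (by omega) h.1
      · exact absurd h.2 (by simp [hq.le])
    set V := hvm.mk v with hV
    have hVm : Measurable V := hvm.measurable_mk
    have hVe : v =ᵐ[volume] V := hvm.ae_eq_mk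
    -- Dividing by `I^{1/p}` needs `I` finite. Truncation provides this, with a final bound
    -- independent of `k`.
    set E : ℕ → Set (Fin n → ℝ) := fun k => R ∩ {x | V x ≤ k} with hE
    have hEm : ∀ k, MeasurableSet (E k) := fun k =>
      hRm.inter (measurableSet_le hVm measurable_const)
    have hEt : ∀ k, ∫⁻ x in E k, v x ≠ ∞ := by
      intro k
      refine ne_top_of_le_ne_top ?_ (setLIntegral_mono_ae' (g := fun _ => (k : ℝ≥0∞)) (hEm k) ?_)
      · rw [setLIntegral_const]
        refine ENNReal.mul_ne_top (ENNReal.natCast_ne_top k) (ne_top_of_le_ne_top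
          (isCompact_cube _ _).measure_ne_top (measure_mono Set.inter_subset_left))
      · filter_upwards [hVe] with x hx hxE
        rw [hx]; exact hxE.2
    have hEb : ∀ k, ∫⁻ x in E k, v x ≤ (K' / d) ^ (p / (p - 1)) := by
      intro k
      set I := ∫⁻ x in E k, v x with hI
      by_cases hI0 : I = 0
      · rw [hI0]; exact zero_le
      have h1 : d * I ≤ K' * I ^ (1 / p) := by
        have := hcube _ _ hl (E k) Set.inter_subset_left (hEm k) (hEt k)
        rw [mul_right_comm] at this
        exact this
      have h2 : I ^ (1 - 1 / p) ≤ K' / d := by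
        -- `d` may be `∞`, as `u` is not yet known to be locally integrable; `K' ≠ ∞` suffices.
        rw [ENNReal.le_div_iff_mul_le (Or.inl hd0) (Or.inr hKt)]
        calc I ^ (1 - 1 / p) * d = d * I * I ^ (-(1 / p)) := by
              rw [sub_eq_add_neg, ENNReal.rpow_add _ _ hI0 (hEt k), ENNReal.rpow_one]; ring
          _ ≤ K' * I ^ (1 / p) * I ^ (-(1 / p)) := by gcongr
          _ = K' := by
              rw [mul_assoc, ← ENNReal.rpow_add _ _ hI0 (hEt k)]; simp
      calc I = (I ^ (1 - 1 / p)) ^ (p / (p - 1)) := by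
            rw [← ENNReal.rpow_mul, show (1 - 1 / p) * (p / (p - 1)) = 1 by field_simp,
              ENNReal.rpow_one]
        _ ≤ _ := by gcongr
    have hEmono : Monotone E := fun j k hjk x hx =>
      ⟨hx.1, le_trans (show V x ≤ j from hx.2) (by exact_mod_cast hjk)⟩
    have hEU : (⋃ k, E k) =ᵐ[volume] R := by
      filter_upwards [hVe, hvt] with x h1 h2
      refine propext ⟨fun h => (Set.mem_iUnion.1 h).elim fun k hk => hk.1, fun h => ?_⟩
      rw [h1] at h2
      obtain ⟨k, hk⟩ := ENNReal.exists_nat_gt h2.ne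
      exact Set.mem_iUnion.2 ⟨k, h, hk.le⟩
    have hRE : ∫⁻ x in R, v x ≤ (K' / d) ^ (p / (p - 1)) := by
      rw [← Measure.restrict_congr_set hEU,
        ← withDensity_apply _ (MeasurableSet.iUnion hEm), hEmono.measure_iUnion]
      exact iSup_le fun k => by rw [withDensity_apply _ (hEm k)]; exact hEb k
    exact ne_top_of_le_ne_top (ENNReal.rpow_ne_top_of_nonneg (div_nonneg hp0.le hp1.le)
      (ENNReal.div_ne_top hKt hd0)) hRE
  have hvw : IsWeight v := IsWeight.of_centeredCube hvm (N₁ + 1) hvint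
  refine ⟨hw, IsWeight.of_centeredCube hum (N₁ + 1) fun N hN => ?_, hvw, ?_⟩
  -- With `v(Q)` positive and finite, the same inequality rules out `u(Q) = ∞`.
  · have hl := hpos N hN
    have h := hcube _ _ hl _ subset_rfl (measurableSet_cube _ _) (hvint N hN)
    intro htop
    have h0 := setLIntegral_cube_ne_zero hvm hv0 (fun _ => -(N : ℝ)) hl
    rw [show ∫⁻ y in cube (fun _ => -(N : ℝ)) (2 * N), u y = ∞ from htop,
      ENNReal.top_rpow_of_pos (by positivity),
      ENNReal.mul_top (mul_ne_zero (volume_cube_rpow_ne_zero _ hl _) h0), top_le_iff] at h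
    exact ENNReal.mul_ne_top hKt
      (ENNReal.rpow_ne_top_of_nonneg (by positivity) (hvint N hN)) h
  · refine lt_of_le_of_lt (iSup₂_le fun a l => iSup_le fun hl => ?_) hKt.lt_top
    have h0 := setLIntegral_cube_ne_zero hvm hv0 a hl
    have ht := setLIntegral_cube_ne_top hvw a l
    calc (∫⁻ x in cube a l, v x) ^ (-(1 / p)) *
          (∫⁻ x in cube a l, (fracMaximal α ((cube a l).indicator v) x) ^ q * u x) ^ (1 / q)
        ≤ (∫⁻ x in cube a l, v x) ^ (-(1 / p)) * (K' * (∫⁻ x in cube a l, v x) ^ (1 / p)) := by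
          gcongr
          refine le_trans ?_ (htest _ (measurableSet_cube a l) ht)
          exact ENNReal.rpow_le_rpow (setLIntegral_le_lintegral _ _) (by positivity)
      _ = K' := by
          rw [mul_left_comm, ← ENNReal.rpow_add _ _ h0 ht]; simp

end Necessity

/-! ### The characterization -/

theorem corollary1p2 (n : ℕ) (α p q : ℝ) (hα : 0 ≤ α) (hαn : α < n) (hp : 1 < p)
    (hαp : α * p < n) (hq : 1 / q = 1 / p - α / n) :
    ∃ C : ℝ≥0, ∀ A : Matrix (Fin n) (Fin n) ℝ, A.det ≠ 0 →
      ∀ w : (Fin n → ℝ) → ℝ≥0∞, IsWeight w → ¬ (∀ᵐ x, w x = 0) →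
        (MatrixSawyerClass α A p q w ↔ ∃ K : ℝ≥0, StrongBound α A p q w K) ∧
        (MatrixSawyerClass α A p q w →
          StrongBound α A p q w
            (C * ENNReal.ofReal |A.det| ^ (1 / q) * matrixSawyerConst α A p q w)) := by
  have hp0 : 0 < p := by linarith
  have hn : (0 : ℝ) < n := hα.trans_lt hαn
  have hq1 : 0 < 1 / q := by
    rw [hq, sub_pos, div_lt_div_iff₀ hn hp0]
    linarith
  have hq0 : 0 < q := one_div_pos.1 hq1
  have hpq : p ≤ q := by
    rw [← one_div_le_one_div hq0 hp0, hq]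
    have : 0 ≤ α / n := by positivity
    linarith
  have hC : ((6 : ℝ≥0∞) ^ ((n - α) * q) *
      (2 ^ n * (2 ^ q * ENNReal.ofReal q / ENNReal.ofReal (p - 1)))) ^ (1 / q) ≠ ∞ := by
    refine ENNReal.rpow_ne_top_of_nonneg hq1.le (ENNReal.mul_ne_top ?_ (ENNReal.mul_ne_top ?_
      (ENNReal.div_ne_top (ENNReal.mul_ne_top ?_ ENNReal.ofReal_ne_top) ?_)))
    · exact ENNReal.rpow_ne_top_of_nonneg (mul_nonneg (by linarith) hq0.le) (by simp)
    · exact ENNReal.pow_ne_top (by simp)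
    · exact ENNReal.rpow_ne_top_of_nonneg hq0.le (by simp)
    · exact (ENNReal.ofReal_pos.2 (by linarith)).ne'
  -- The constant of `strongBound_of_matrixSawyerClass`: it involves only `n`, `α`, `p` and `q`, and
  -- `q` is determined by the others.
  obtain ⟨C, hCeq⟩ : ∃ C : ℝ≥0, (C : ℝ≥0∞) = _ := ⟨_, ENNReal.coe_toNNReal hC⟩
  refine ⟨C, fun A hA w hw hwz => ?_⟩
  have h2 : MatrixSawyerClass α A p q w → StrongBound α A p q w
      (C * ENNReal.ofReal |A.det| ^ (1 / q) * matrixSawyerConst α A p q w) := fun h => by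
    rw [hCeq]
    exact strongBound_of_matrixSawyerClass hα hαn hp hpq hA h
  refine ⟨⟨fun h => ?_, fun ⟨K, hK⟩ => matrixSawyerClass_of_strongBound hp hq0 hA hw hwz hK⟩, h2⟩
  obtain ⟨K, hK⟩ : ∃ K : ℝ≥0, (K : ℝ≥0∞) = _ := ⟨_, ENNReal.coe_toNNReal (ENNReal.mul_ne_top (ENNReal.mul_ne_top
    (ENNReal.coe_ne_top (r := C)) (ENNReal.rpow_ne_top_of_nonneg hq1.le
    (ENNReal.ofReal_ne_top (r := |A.det|)))) h.2.const_lt_top.ne)⟩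
  exact ⟨K, by rw [hK]; exact h2 h⟩
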